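/- All $C^*$-algebras are finite-dimensional and unital; $\varsigma$ is the flip of $M\otimes M$ and $\mu:M\otimes M\to M$ is multiplication. **Weak Kac algebras.** A weak Kac algebra is $(M,\Delta,S,\varepsilon)$, where $M$ is a $C^*$-algebra; $\Delta:M\to M\otimes M$ is an injective, not necessarily unital, $*$-homomorphism with $(\Delta\otimes\mathrm{id})\Delta=(\mathrm{id}\otimes\Delta)\Delta$; $S:M\to M$ is a unital anti-$*$-automorphism with $S^2=\mathrm{id}$ and $(S\otimes S)\Delta=\varsigma\Delta S$; and $\varepsilon:M\to\mathbb C$ is a linear map such that $(\varepsilon\otimes\mathrm{id})\Delta=(\mathrm{id}\otimes\varepsilon)\Delta=\mathrm{id}$, $\varepsilon(S(x))=\varepsilon(x)$, $\varepsilon(x^*)=\overline{\varepsilon(x)}$, $(\varepsilon\otimes\varepsilon)((x\otimes1)\Delta(1)(1\otimes y))=\varepsilon(xy)$ and $(\varepsilon_s\otimes\mathrm{id})\Delta(x)=(1\otimes x)\Delta(1)$ for all $x,y\in M$, with $\varepsilon_s=\mu(S\otimes\mathrm{id})\Delta$. Morphisms are the unital $*$-homomorphisms $\pi$ with $(\pi\otimes\pi)\Delta_1=\Delta_2\pi$,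 $\pi S_1=S_2\pi$ and $\varepsilon_2\pi=\varepsilon_1$. **Fibered product.** Let $s:N\to M$ be a unital anti-$*$-homomorphism and $t:N\to M$ a unital $*$-homomorphism of $C^*$-algebras. Let $e_{s,t}\in M\otimes M$ be the support of the canonical map of $L^2(M)\otimes L^2(M)$ onto the relative tensor product $L^2(M)\otimes_N L^2(M)$, i.e. the unique projection such that $\{x\in M\otimes M: e_{s,t}x=0\}$ is the linear span of the elements $s(n)\zeta\otimes\eta-\zeta\otimes t(n)\eta$ ($n\in N$, $\zeta,\eta\in M$). The fibered product is the reduced algebra $M\,{}_s{*}_t\,M=e_{s,t}(M\otimes M)e_{s,t}$, with unit $e_{s,t}$; let $i_{s,t}$ be its inclusion into $M\otimes M$. **Kac bimodules.** A coinvolutive Hopf bimodule is $(N,M,t,\Delta,S)$, where $N,M$ are $C^*$-algebras, $t:N\to M$ is an injective unital $*$-homomorphism, $S:M\to M$ is a unital anti-$*$-automorphism with $S^2=\mathrm{id}$ such that $s:=S\circ t$ satisfies $s(n)t(n')=t(n')s(n)$, and $\Delta:M\to M\,{}_s{*}_t\,M$ is an injective unital $*$-homomorphism such that, with $\tilde\Delta=i_{s,t}\circ\Delta$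 and for all $n\in N$, $$\tilde\Delta(t(n))=(t(n)\otimes1)e_{s,t},\quad \tilde\Delta(s(n))=(1\otimes s(n))e_{s,t},\quad (\tilde\Delta\otimes\mathrm{id})\tilde\Delta=(\mathrm{id}\otimes\tilde\Delta)\tilde\Delta,\quad (S\otimes S)\tilde\Delta=\varsigma\tilde\Delta S.$$ It is counital if $\varepsilon_t:=\mu(\mathrm{id}\otimes S)\tilde\Delta$ satisfies $\varepsilon_t(1)=1$, $\varepsilon_t(M)\subset t(N)$, and $\varepsilon_t(t(n)s(n')x)=t(n)\varepsilon_t(x)t(n')$ for all $n,n'\in N$, $x\in M$. A Kac bimodule is a counital one such that $(\mathrm{id}\otimes\varepsilon)\tilde\Delta=\mathrm{id}$, where $\varepsilon=\theta_t\circ\varepsilon_t$ and $\theta_t$ is the trace of the left regular representation of $t(N)$. A morphism of Kac bimodules $(N_1,M_1,t_1,\Delta_1,S_1)\to(N_2,M_2,t_2,\Delta_2,S_2)$ is a pair of a $*$-isomorphism $f:N_1\to N_2$ and a unital $*$-homomorphism $\pi:M_1\to M_2$ with $\pi t_1=t_2f$, $(\pi\otimes\pi)\tilde\Delta_1=\tilde\Delta_2\pi$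 and $\pi S_1=S_2\pi$. **Theorem.** The categories of Kac bimodules and of weak Kac algebras are equivalent. More precisely, there is an equivalence from the first to the second which, up to natural isomorphism, is given by $(N,M,t,\Delta,S)\mapsto(M,i_{s,t}\circ\Delta,S,\varepsilon)$ on objects and $(f,\pi)\mapsto\pi$ on morphisms. -/

import Mathlib

open scoped TensorProduct

universe u

noncomputable section

/-- The trace of the left regular representation. -/
def regularTrace (A : Type*) [Ring A] [Algebra ℂ A] : A →ₗ[ℂ] ℂ :=
  LinearMap.trace ℂ A ∘ₗ LinearMap.mul ℂ A

namespace FaithfulFunctional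

open scoped ComplexOrder

theorem pow_eq_zero_of_selfAdjoint {A : Type*} [CStarAlgebra A] {a : A} (ha : IsSelfAdjoint a)
    {n : ℕ} (h : a ^ n = 0) : a = 0 := by
  have h2 : a ^ 2 ^ n = 0 := by
    have : n ≤ 2 ^ n := Nat.lt_two_pow_self.le
    obtain ⟨k, hk⟩ := Nat.exists_eq_add_of_le this
    rw [hk, pow_add, h, zero_mul]
  have h3 := ha.nnnorm_pow_two_pow n
  rw [h2, nnnorm_zero] at h3
  exact nnnorm_eq_zero.mp (pow_eq_zero_iff (by positivity) |>.mp h3.symm)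

theorem roots_nonneg {A : Type*} [CStarAlgebra A] [FiniteDimensional ℂ A] (x : A) (μ : ℂ)
    (h : μ ∈ (LinearMap.mul ℂ A (star x * x)).charpoly.roots) : 0 ≤ μ := by
  have h1 := (Polynomial.mem_roots'.mp h).2
  rw [← Module.End.hasEigenvalue_iff_isRoot_charpoly, Module.End.hasEigenvalue_iff_mem_spectrum] at h1
  have h2 : μ ∈ spectrum ℂ (star x * x) := AlgHom.spectrum_apply_subset (Algebra.lmul ℂ A) _ h1
  have hs : IsSelfAdjoint (star x * x) := IsSelfAdjoint.star_mul_self x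
  have h3 := hs.mem_spectrum_eq_re h2
  rw [h3] at h2 ⊢
  have h4 : μ.re ∈ spectrum ℝ (star x * x) := by
    rw [spectrum.mem_iff] at h2 ⊢
    have e : (algebraMap ℝ A) μ.re = (algebraMap ℂ A) (μ.re : ℂ) :=
      IsScalarTower.algebraMap_apply ℝ ℂ A μ.re
    rwa [e]
  exact_mod_cast spectrum_star_mul_self_nonneg _ h4

theorem regularTrace_eq {A : Type*} [CStarAlgebra A] [FiniteDimensional ℂ A] (x : A) :
    regularTrace A x = (LinearMap.mul ℂ A x).charpoly.roots.sum :=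
  Module.End.trace_eq_sum_roots_charpoly_of_splits (IsAlgClosed.splits _)

theorem regularTrace_nonneg {A : Type*} [CStarAlgebra A] [FiniteDimensional ℂ A] (x : A) :
    0 ≤ regularTrace A (star x * x) := by
  rw [regularTrace_eq]
  exact Multiset.sum_nonneg (roots_nonneg x)

theorem regularTrace_definite {A : Type*} [CStarAlgebra A] [FiniteDimensional ℂ A] (x : A)
    (h : regularTrace A (star x * x) = 0) : x = 0 := by
  rw [regularTrace_eq] at h
  have h0 := Multiset.all_zero_of_le_zero_le_of_sum_eq_zero (roots_nonneg x) h
  have hr : (LinearMap.mul ℂ A (star x * x)).charpoly.roots =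
      Multiset.replicate (Multiset.card (LinearMap.mul ℂ A (star x * x)).charpoly.roots) 0 :=
    Multiset.eq_replicate_card.mpr h0
  have hX := (IsAlgClosed.splits (LinearMap.mul ℂ A (star x * x)).charpoly).eq_prod_roots_of_monic
    (LinearMap.charpoly_monic _)
  rw [hr, Multiset.map_replicate, Multiset.prod_replicate, Polynomial.C_0, sub_zero] at hX
  have hd := congrArg Polynomial.natDegree hX
  rw [LinearMap.charpoly_natDegree, Polynomial.natDegree_X_pow] at hd
  rw [← hd] at hX
  obtain ⟨n, hn⟩ := (LinearMap.charpoly_eq_X_pow_iff _).mp hX 1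
  have hp : ∀ m : ℕ, ((LinearMap.mul ℂ A (star x * x)) ^ m) 1 = (star x * x) ^ m := by
    intro m
    induction m with
    | zero => simp
    | succ k ih => rw [pow_succ', Module.End.mul_apply, ih, LinearMap.mul_apply', pow_succ']
  rw [hp] at hn
  exact CStarRing.star_mul_self_eq_zero_iff x |>.mp
    (pow_eq_zero_of_selfAdjoint (IsSelfAdjoint.star_mul_self x) hn)

/-- A faithful positive linear functional on a complex *-algebra. -/
structure IsFaithfulPositive {A : Type*} [Ring A] [StarRing A] [Algebra ℂ A]
    (φ : A →ₗ[ℂ] ℂ) : Prop where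
  map_star : ∀ x, φ (star x) = star (φ x)
  nonneg : ∀ x, 0 ≤ φ (star x * x)
  definite : ∀ x, φ (star x * x) = 0 → x = 0

theorem map_star_of_nonneg {A : Type*} [Ring A] [StarRing A] [Algebra ℂ A] [StarModule ℂ A]
    (φ : A →ₗ[ℂ] ℂ) (h : ∀ x, 0 ≤ φ (star x * x)) (x : A) : φ (star x) = star (φ x) := by
  have him : ∀ y, (φ (star y * y)).im = 0 := fun y => ((Complex.nonneg_iff.mp (h y)).2).symm
  have h1 := him (1 + x)
  have h2 := him (1 + Complex.I • x)
  have e1 : star (1 + x) * (1 + x) = star (1 : A) * 1 + x + star x + star x * x := by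
    simp [mul_add, add_mul]; abel
  have e2 : star (1 + Complex.I • x) * (1 + Complex.I • x) =
      star (1 : A) * 1 + Complex.I • x - Complex.I • star x + star x * x := by
    simp [mul_add, add_mul, smul_smul, star_smul]; abel
  rw [e1] at h1
  rw [e2] at h2
  simp only [map_add, map_sub, map_smul, Complex.add_im, Complex.sub_im, him, smul_eq_mul,
    Complex.mul_im, Complex.I_re, Complex.I_im] at h1 h2
  apply Complex.ext
  · simp; linarith
  · simp; linarith

theorem regularTrace_isFaithfulPositive (A : Type*) [CStarAlgebra A] [FiniteDimensional ℂ A] :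
    IsFaithfulPositive (regularTrace A) where
  map_star := map_star_of_nonneg _ regularTrace_nonneg
  nonneg := regularTrace_nonneg
  definite := regularTrace_definite

/-- The inner product `⟨x, y⟩ = φ (x* y)` defined by a faithful positive functional. -/
abbrev IsFaithfulPositive.core {A : Type*} [Ring A] [StarRing A] [Algebra ℂ A] [StarModule ℂ A]
    {φ : A →ₗ[ℂ] ℂ} (h : IsFaithfulPositive φ) : InnerProductSpace.Core ℂ A where
  inner x y := φ (star x * y)
  conj_inner_symm x y := by
    have := h.map_star (star y * x)
    rw [star_mul, star_star] at this
    exact this.symm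
  re_inner_nonneg x := (Complex.nonneg_iff.mp (h.nonneg x)).1
  add_left x y z := by simp [add_mul]
  smul_left x y r := by simp [star_smul]
  definite x hx := h.definite x hx

theorem exists_orthonormal_basis {V : Type*} [AddCommGroup V] [Module ℂ V]
    [FiniteDimensional ℂ V] (c : InnerProductSpace.Core ℂ V) :
    ∃ b : Module.Basis (Fin (Module.finrank ℂ V)) ℂ V,
      ∀ i j, c.inner (b i) (b j) = if i = j then 1 else 0 := by
  let _ := c.toNormedAddCommGroup
  let _ := InnerProductSpace.ofCore c.toCore
  refine ⟨(stdOrthonormalBasis ℂ V).toBasis, fun i j => ?_⟩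
  simp only [OrthonormalBasis.coe_toBasis]
  exact orthonormal_iff_ite.mp (stdOrthonormalBasis ℂ V).orthonormal i j

theorem exists_projection {V : Type*} [AddCommGroup V] [Module ℂ V]
    [FiniteDimensional ℂ V] (c : InnerProductSpace.Core ℂ V) (K : Submodule ℂ V) (v : V) :
    ∃ k ∈ K, ∀ w ∈ K, c.inner w (v - k) = 0 := by
  let _ := c.toNormedAddCommGroup
  let _ := InnerProductSpace.ofCore c.toCore
  refine ⟨K.starProjection v, K.starProjection_apply_mem v, fun w hw => ?_⟩
  exact inner_eq_zero_symm.mp (K.starProjection_inner_eq_zero v w hw)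

theorem regularTrace_tmul {A B : Type*} [Ring A] [Algebra ℂ A] [FiniteDimensional ℂ A]
    [Ring B] [Algebra ℂ B] [FiniteDimensional ℂ B] (x : A) (y : B) :
    regularTrace (A ⊗[ℂ] B) (x ⊗ₜ y) = regularTrace A x * regularTrace B y := by
  simp only [regularTrace, LinearMap.comp_apply]
  rw [← LinearMap.trace_tensorProduct']
  congr 1
  ext a b
  simp

theorem regularTrace_tensor_isFaithfulPositive (A B : Type*)
    [CStarAlgebra A] [FiniteDimensional ℂ A] [CStarAlgebra B] [FiniteDimensional ℂ B] :
    IsFaithfulPositive (regularTrace (A ⊗[ℂ] B)) := by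
  have hA := regularTrace_isFaithfulPositive A
  have hB := regularTrace_isFaithfulPositive B
  obtain ⟨b, hb⟩ := exists_orthonormal_basis hA.core
  have key : ∀ z : A ⊗[ℂ] B, ∃ y : Fin (Module.finrank ℂ A) → B,
      z = ∑ i, b i ⊗ₜ[ℂ] y i ∧
      regularTrace (A ⊗[ℂ] B) (star z * z) = ∑ i, regularTrace B (star (y i) * y i) := by
    intro z
    have hz : ∃ y : Fin (Module.finrank ℂ A) → B, z = ∑ i, b i ⊗ₜ[ℂ] y i := by
      induction z with
      | zero => exact ⟨0, by simp⟩
      | tmul x y =>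
        refine ⟨fun i => b.repr x i • y, ?_⟩
        simp only [← TensorProduct.smul_tmul, ← TensorProduct.sum_tmul, b.sum_repr]
      | add z w hz hw =>
        obtain ⟨y, rfl⟩ := hz
        obtain ⟨y', rfl⟩ := hw
        exact ⟨y + y', by simp [TensorProduct.tmul_add, Finset.sum_add_distrib]⟩
    obtain ⟨y, hy⟩ := hz
    refine ⟨y, hy, ?_⟩
    have hb' : ∀ i j, regularTrace A (star (b i) * b j) = if i = j then 1 else 0 := hb
    rw [hy]
    simp only [star_sum, TensorProduct.star_tmul, Finset.sum_mul, Finset.mul_sum,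
      Algebra.TensorProduct.tmul_mul_tmul, map_sum, regularTrace_tmul, hb']
    simp
  have hnn : ∀ z : A ⊗[ℂ] B, 0 ≤ regularTrace (A ⊗[ℂ] B) (star z * z) := by
    intro z
    obtain ⟨y, -, h⟩ := key z
    rw [h]
    exact Finset.sum_nonneg fun i _ => hB.nonneg _
  refine ⟨map_star_of_nonneg _ hnn, hnn, fun z hz => ?_⟩
  obtain ⟨y, h1, h2⟩ := key z
  rw [h2, Finset.sum_eq_zero_iff_of_nonneg (fun i _ => hB.nonneg _)] at hz
  have : ∀ i, y i = 0 := fun i => hB.definite _ (hz i (Finset.mem_univ i))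
  simp [h1, this]

theorem exists_support {A : Type*} [Ring A] [StarRing A] [Algebra ℂ A] [StarModule ℂ A]
    [FiniteDimensional ℂ A] {φ : A →ₗ[ℂ] ℂ} (h : IsFaithfulPositive φ) (K : Submodule ℂ A)
    (hK : ∀ x ∈ K, ∀ a, x * a ∈ K) :
    ∃ e : A, IsStarProjection e ∧ ∀ x, e * x = 0 ↔ x ∈ K := by
  obtain ⟨k, hk, ho⟩ := exists_projection h.core K 1
  have ho' : ∀ w ∈ K, star w * (1 - k) = 0 := by
    intro w hw
    apply h.definite
    have e : φ (star (w * (star w * (1 - k))) * (1 - k)) = 0 := ho _ (hK w hw _)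
    rwa [star_mul, mul_assoc] at e
  have hkk : star k * (1 - k) = 0 := ho' k hk
  have hk1 : star k = star k * k := by
    rw [mul_sub, mul_one, sub_eq_zero] at hkk; exact hkk
  have hks : star k = k := by
    have := congrArg star hk1
    rw [star_mul, star_star] at this
    rw [hk1, ← this]
  refine ⟨1 - k, ⟨?_, ?_⟩, fun x => ⟨fun hx => ?_, fun hx => ?_⟩⟩
  · rw [hks] at hkk
    rw [IsIdempotentElem, sub_mul, one_mul, hkk, sub_zero]
  · rw [IsSelfAdjoint, star_sub, star_one, hks]
  · rw [sub_mul, one_mul, sub_eq_zero] at hx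
    rw [hx]; exact hK k hk x
  · have := congrArg star (ho' x hx)
    rwa [star_mul, star_star, star_zero, star_sub, star_one, hks] at this

end FaithfulFunctional

/-! ### Anti-*-homomorphisms -/

/-- A unital anti-*-homomorphism of complex *-algebras. -/
structure AntiStarHom (A B : Type*) [Ring A] [StarRing A] [Algebra ℂ A]
    [Ring B] [StarRing B] [Algebra ℂ B] extends A →ₗ[ℂ] B where
  map_one' : toFun 1 = 1
  map_mul' : ∀ x y, toFun (x * y) = toFun y * toFun x
  map_star' : ∀ x, toFun (star x) = star (toFun x)

instance {A B : Type*} [Ring A] [StarRing A] [Algebra ℂ A]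
    [Ring B] [StarRing B] [Algebra ℂ B] : CoeFun (AntiStarHom A B) fun _ => A → B :=
  ⟨fun f => f.toLinearMap⟩

/-! ### The relative tensor product and the fibered product

`N`, `M₁`, `M₂` are finite-dimensional C*-algebras, `β : N → M₁` is an anti-*-homomorphism and
`γ : N → M₂` is a *-homomorphism.  The algebras `M₁`, `M₂` act by left multiplication on the
Hilbert spaces `L²(M₁)`, `L²(M₂)`, whose underlying vector spaces are `M₁` and `M₂`, and
`M₁ ⊗ M₂` acts by left multiplication on `L²(M₁) ⊗ L²(M₂)`. -/

section FiberedProduct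

variable {N M₁ M₂ : Type*} [CStarAlgebra N] [CStarAlgebra M₁] [CStarAlgebra M₂]

/-- The span of the vectors `β(n)ζ ⊗ η - ζ ⊗ γ(n)η`. -/
def balancedRelations (β : AntiStarHom N M₁) (γ : N →⋆ₐ[ℂ] M₂) : Submodule ℂ (M₁ ⊗[ℂ] M₂) :=
  Submodule.span ℂ {z | ∃ (n : N) (ζ : M₁) (η : M₂), z = (β n * ζ) ⊗ₜ η - ζ ⊗ₜ (γ n * η)}

/-- The relative tensor product of `L²(M₁)` and `L²(M₂)` over `N` (in finite dimension, the
quotient of the tensor product by the relations `β(n)ζ ⊗ η = ζ ⊗ γ(n)η`). -/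
abbrev RelativeTensor (β : AntiStarHom N M₁) (γ : N →⋆ₐ[ℂ] M₂) : Type _ :=
  (M₁ ⊗[ℂ] M₂) ⧸ balancedRelations β γ

/-- The canonical operator from the tensor product onto the relative tensor product. -/
def RelativeTensor.mk (β : AntiStarHom N M₁) (γ : N →⋆ₐ[ℂ] M₂) :
    M₁ ⊗[ℂ] M₂ →ₗ[ℂ] RelativeTensor β γ :=
  (balancedRelations β γ).mkQ

variable [FiniteDimensional ℂ M₁] [FiniteDimensional ℂ M₂]

theorem exists_fiberProjection (β : AntiStarHom N M₁) (γ : N →⋆ₐ[ℂ] M₂) :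
    ∃ e : M₁ ⊗[ℂ] M₂, IsStarProjection e ∧ ∀ x, e * x = 0 ↔ RelativeTensor.mk β γ x = 0 := by
  simp only [RelativeTensor.mk, Submodule.mkQ_apply, Submodule.Quotient.mk_eq_zero]
  refine FaithfulFunctional.exists_support
    (FaithfulFunctional.regularTrace_tensor_isFaithfulPositive M₁ M₂) _ fun x hx a => ?_
  induction hx using Submodule.span_induction with
  | mem x h =>
    obtain ⟨n, ζ, η, rfl⟩ := h
    induction a with
    | zero => simp
    | tmul c d =>
      refine Submodule.subset_span ⟨n, ζ * c, η * d, ?_⟩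
      simp [sub_mul, mul_assoc]
    | add a b ha hb => rw [mul_add]; exact add_mem ha hb
  | zero => simp
  | add x y _ _ hx hy => rw [add_mul]; exact add_mem hx hy
  | smul c x _ hx => rw [smul_mul_assoc]; exact Submodule.smul_mem _ _ hx

/-- The support of the canonical operator onto the relative tensor product: the projection
`e` in `M₁ ⊗ M₂` such that `ker e = ker (RelativeTensor.mk β γ)`. -/
def fiberProjection (β : AntiStarHom N M₁) (γ : N →⋆ₐ[ℂ] M₂) : M₁ ⊗[ℂ] M₂ :=
  (exists_fiberProjection β γ).choose

theorem fiberProjection_isStarProjection (β : AntiStarHom N M₁) (γ : N →⋆ₐ[ℂ] M₂) :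
    IsStarProjection (fiberProjection β γ) :=
  (exists_fiberProjection β γ).choose_spec.1

theorem fiberProjection_mul_eq_zero_iff (β : AntiStarHom N M₁) (γ : N →⋆ₐ[ℂ] M₂)
    (x : M₁ ⊗[ℂ] M₂) : fiberProjection β γ * x = 0 ↔ RelativeTensor.mk β γ x = 0 :=
  (exists_fiberProjection β γ).choose_spec.2 x

theorem eq_fiberProjection (β : AntiStarHom N M₁) (γ : N →⋆ₐ[ℂ] M₂) (e : M₁ ⊗[ℂ] M₂)
    (he : IsStarProjection e) (h : ∀ x, e * x = 0 ↔ RelativeTensor.mk β γ x = 0) :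
    e = fiberProjection β γ := by
  have hf := fiberProjection_isStarProjection β γ
  have h1 : e = e * fiberProjection β γ := by
    have : e * (1 - fiberProjection β γ) = 0 := by
      rw [h, ← fiberProjection_mul_eq_zero_iff, mul_sub, mul_one, hf.isIdempotentElem.eq, sub_self]
    rwa [mul_sub, mul_one, sub_eq_zero] at this
  have h2 : fiberProjection β γ = fiberProjection β γ * e := by
    have : fiberProjection β γ * (1 - e) = 0 := by
      rw [fiberProjection_mul_eq_zero_iff, ← h, mul_sub, mul_one, he.isIdempotentElem.eq, sub_self]
    rwa [mul_sub, mul_one, sub_eq_zero] at this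
  have h3 := congrArg star h1
  rw [star_mul, he.isSelfAdjoint.star_eq, hf.isSelfAdjoint.star_eq, ← h2] at h3
  exact h3

/-- The reduced algebra `e (M₁ ⊗ M₂) e`, as a *-subalgebra (without the same unit) of
`M₁ ⊗ M₂`, where `e` is the projection `fiberProjection β γ`. -/
def fiberedSubalgebra (β : AntiStarHom N M₁) (γ : N →⋆ₐ[ℂ] M₂) :
    NonUnitalStarSubalgebra ℂ (M₁ ⊗[ℂ] M₂) where
  carrier := {x | fiberProjection β γ * x = x ∧ x * fiberProjection β γ = x}
  add_mem' := fun {a b} ha hb =>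
    ⟨by rw [mul_add, ha.1, hb.1], by rw [add_mul, ha.2, hb.2]⟩
  zero_mem' := ⟨mul_zero _, zero_mul _⟩
  mul_mem' := fun {a b} ha hb => ⟨by rw [← mul_assoc, ha.1], by rw [mul_assoc, hb.2]⟩
  smul_mem' := fun c x hx => ⟨by rw [mul_smul_comm, hx.1], by rw [smul_mul_assoc, hx.2]⟩
  star_mem' := fun {a} ha => by
    have hs := (fiberProjection_isStarProjection β γ).isSelfAdjoint.star_eq
    constructor
    · have := congrArg star ha.2
      rwa [star_mul, hs] at this
    · have := congrArg star ha.1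
      rwa [star_mul, hs] at this

/-- The fibered product of `M₁` and `M₂` over `N` with respect to `β` and `γ`: the
reduction of `M₁ ⊗ M₂` by `fiberProjection β γ`, a *-algebra whose unit is that projection. -/
def FiberedProduct (β : AntiStarHom N M₁) (γ : N →⋆ₐ[ℂ] M₂) : Type _ :=
  fiberedSubalgebra β γ

namespace FiberedProduct

variable (β : AntiStarHom N M₁) (γ : N →⋆ₐ[ℂ] M₂)

instance : NonUnitalRing (FiberedProduct β γ) :=
  inferInstanceAs (NonUnitalRing (fiberedSubalgebra β γ))

instance : StarRing (FiberedProduct β γ) :=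
  inferInstanceAs (StarRing (fiberedSubalgebra β γ))

instance : Module ℂ (FiberedProduct β γ) :=
  inferInstanceAs (Module ℂ (fiberedSubalgebra β γ))

instance : StarModule ℂ (FiberedProduct β γ) :=
  inferInstanceAs (StarModule ℂ (fiberedSubalgebra β γ))

/-- The canonical non-unital injection of the fibered product into the tensor product. -/
def incl : FiberedProduct β γ →⋆ₙₐ[ℂ] M₁ ⊗[ℂ] M₂ :=
  NonUnitalStarSubalgebraClass.subtype (fiberedSubalgebra β γ)

theorem incl_injective : Function.Injective (incl β γ) :=
  Subtype.coe_injective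

/-- The element of the fibered product given by an element of the reduced algebra. -/
def ofMem (x : M₁ ⊗[ℂ] M₂) (h₁ : fiberProjection β γ * x = x)
    (h₂ : x * fiberProjection β γ = x) : FiberedProduct β γ :=
  (⟨x, h₁, h₂⟩ : fiberedSubalgebra β γ)

theorem incl_ofMem (x : M₁ ⊗[ℂ] M₂) (h₁ : fiberProjection β γ * x = x)
    (h₂ : x * fiberProjection β γ = x) : incl β γ (ofMem β γ x h₁ h₂) = x := rfl

theorem fiberProjection_mul_incl (x : FiberedProduct β γ) :
    fiberProjection β γ * incl β γ x = incl β γ x := x.2.1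

theorem incl_mul_fiberProjection (x : FiberedProduct β γ) :
    incl β γ x * fiberProjection β γ = incl β γ x := x.2.2

instance : One (FiberedProduct β γ) :=
  ⟨ofMem β γ (fiberProjection β γ)
    (fiberProjection_isStarProjection β γ).isIdempotentElem
    (fiberProjection_isStarProjection β γ).isIdempotentElem⟩

theorem incl_one : incl β γ 1 = fiberProjection β γ := rfl

instance : Ring (FiberedProduct β γ) :=
  { (inferInstance : NonUnitalRing (FiberedProduct β γ)),
    (inferInstance : One (FiberedProduct β γ)) with
    one_mul := fun x => Subtype.ext x.2.1
    mul_one := fun x => Subtype.ext x.2.2 }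

instance : Algebra ℂ (FiberedProduct β γ) :=
  Algebra.ofModule
    (fun c x y => incl_injective β γ (smul_mul_assoc c (incl β γ x) (incl β γ y)))
    (fun c x y => incl_injective β γ (mul_smul_comm c (incl β γ x) (incl β γ y)))

/-- The fibered product is the commutant, on the relative tensor product of `L²(M₁)` and
`L²(M₂)`, of the right multiplications by the elements of `M₁ ⊗ M₂` (that is, of
`M₁' ⊗_N M₂'`, as the commutant of `M₁` on `L²(M₁)` consists of right multiplications). -/
theorem existsUnique_of_commute (T : RelativeTensor β γ →ₗ[ℂ] RelativeTensor β γ)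
    (hT : ∀ z w a, T (RelativeTensor.mk β γ z) = RelativeTensor.mk β γ w →
      T (RelativeTensor.mk β γ (z * a)) = RelativeTensor.mk β γ (w * a)) :
    ∃! x : FiberedProduct β γ,
      ∀ z, T (RelativeTensor.mk β γ z) = RelativeTensor.mk β γ (incl β γ x * z) := by
  have hi := (fiberProjection_isStarProjection β γ).isIdempotentElem.eq
  have hmk : ∀ z w, RelativeTensor.mk β γ z = RelativeTensor.mk β γ w ↔
      fiberProjection β γ * z = fiberProjection β γ * w := fun z w => by
    rw [← sub_eq_zero, ← map_sub, ← fiberProjection_mul_eq_zero_iff, mul_sub, sub_eq_zero]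
  have he : ∀ z, RelativeTensor.mk β γ (fiberProjection β γ * z) = RelativeTensor.mk β γ z :=
    fun z => by rw [hmk, ← mul_assoc, hi]
  obtain ⟨w, hw⟩ := Submodule.mkQ_surjective (balancedRelations β γ) (T (RelativeTensor.mk β γ 1))
  have hw' : ∀ z, T (RelativeTensor.mk β γ z) = RelativeTensor.mk β γ (w * z) := fun z => by
    simpa using hT 1 w z hw.symm
  refine ⟨ofMem β γ (fiberProjection β γ * w * fiberProjection β γ) ?_ ?_, fun z => ?_,
    fun y hy => ?_⟩
  · rw [← mul_assoc, ← mul_assoc, hi]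
  · rw [mul_assoc, hi]
  · rw [incl_ofMem, mul_assoc, mul_assoc, he, ← hw', he]
  · have h1 := (hmk _ _).mp ((hy (fiberProjection β γ)).symm.trans (hw' _))
    apply incl_injective
    rw [incl_mul_fiberProjection, fiberProjection_mul_incl] at h1
    rw [incl_ofMem, h1, mul_assoc]

end FiberedProduct

end FiberedProduct

/-! ### Kac bimodules -/

/-- A Hopf bimodule `(N, M, t, s, Δ)` of finite-dimensional C*-algebras. -/
structure HopfBimodule where
  /-- the base -/
  N : Type u
  /-- the total algebra -/
  M : Type u
  [cstarN : CStarAlgebra N]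
  [finN : FiniteDimensional ℂ N]
  [cstarM : CStarAlgebra M]
  [finM : FiniteDimensional ℂ M]
  /-- the target map -/
  t : N →⋆ₐ[ℂ] M
  /-- the source map -/
  s : AntiStarHom N M
  t_injective : Function.Injective t
  s_injective : Function.Injective s
  /-- the coproduct, with values in the fibered product -/
  comul : M →⋆ₐ[ℂ] FiberedProduct s t
  comul_injective : Function.Injective comul
  s_t_comm : ∀ n n', s n * t n' = t n' * s n
  /-- `Δ(t(n)) = t(n) ⊗_N 1` -/
  comul_t : ∀ n, FiberedProduct.incl s t (comul (t n)) = (t n ⊗ₜ 1) * fiberProjection s t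
  /-- `Δ(s(n)) = 1 ⊗_N s(n)` -/
  comul_s : ∀ n, FiberedProduct.incl s t (comul (s n)) = (1 ⊗ₜ s n) * fiberProjection s t
  /-- Coassociativity.  Both iterated fibered products are regarded as subalgebras of
  `M ⊗ M ⊗ M`, on which `Δ * id` and `id * Δ` are the restrictions of `Δ ⊗ id` and `id ⊗ Δ`. -/
  coassoc : ∀ x,
    TensorProduct.assoc ℂ M M M
        (TensorProduct.map
          ((FiberedProduct.incl s t : FiberedProduct s t →ₗ[ℂ] M ⊗[ℂ] M) ∘ₗ
            (comul : M →ₗ[ℂ] FiberedProduct s t)) LinearMap.id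
          (FiberedProduct.incl s t (comul x))) =
      TensorProduct.map LinearMap.id
        ((FiberedProduct.incl s t : FiberedProduct s t →ₗ[ℂ] M ⊗[ℂ] M) ∘ₗ
          (comul : M →ₗ[ℂ] FiberedProduct s t))
        (FiberedProduct.incl s t (comul x))

attribute [instance] HopfBimodule.cstarN HopfBimodule.finN HopfBimodule.cstarM
  HopfBimodule.finM

/-- The coproduct of a Hopf bimodule followed by the canonical injection of the fibered
product into `M ⊗ M`. -/
def HopfBimodule.comulTensor (B : HopfBimodule.{u}) : B.M →⋆ₙₐ[ℂ] B.M ⊗[ℂ] B.M :=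
  (FiberedProduct.incl B.s B.t).comp B.comul.toNonUnitalStarAlgHom

/-- `HopfBimodule.comulTensor` as a linear map. -/
def HopfBimodule.comulLin (B : HopfBimodule.{u}) : B.M →ₗ[ℂ] B.M ⊗[ℂ] B.M :=
  (B.comulTensor : B.M →ₗ[ℂ] B.M ⊗[ℂ] B.M)

/-- A coinvolutive Hopf bimodule `(N, M, t, Δ, S)`, with `s = S ∘ t`. -/
structure CoinvolutiveHopfBimodule extends HopfBimodule.{u} where
  /-- the coinvolution -/
  S : AntiStarHom M M
  S_S : ∀ x, S (S x) = x
  S_t : ∀ n, S (t n) = s n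
  /-- `(S * S) ∘ Δ = Σ ∘ Δ ∘ S` -/
  S_comul : ∀ x, TensorProduct.map S.toLinearMap S.toLinearMap (toHopfBimodule.comulLin x) =
    TensorProduct.comm ℂ M M (toHopfBimodule.comulLin (S x))

/-- The target counital map `ε_t = μ ∘ (id * S) ∘ Δ`. -/
def CoinvolutiveHopfBimodule.targetCounit (B : CoinvolutiveHopfBimodule.{u}) :
    B.M →ₗ[ℂ] B.M :=
  LinearMap.mul' ℂ B.M ∘ₗ TensorProduct.map LinearMap.id B.S.toLinearMap ∘ₗ
    B.toHopfBimodule.comulLin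

/-- A counital Hopf bimodule.  The bimodule structure of `M` is `n · x · n' = t(n) s(n') x`
and that of `t(N)` is `n · y · n' = t(n) y t(n')`. -/
structure CounitalHopfBimodule extends CoinvolutiveHopfBimodule.{u} where
  targetCounit_one : toCoinvolutiveHopfBimodule.targetCounit 1 = 1
  targetCounit_mem : ∀ x, toCoinvolutiveHopfBimodule.targetCounit x ∈ t.range
  targetCounit_bimodule : ∀ (n n' : N) (x : M),
    toCoinvolutiveHopfBimodule.targetCounit (t n * s n' * x) =
      t n * toCoinvolutiveHopfBimodule.targetCounit x * t n'

/-- The functional `ε = θ_t ∘ ε_t`, where `θ_t` is the trace of the left regular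
representation of the algebra `t(N)`. -/
def CounitalHopfBimodule.counit (B : CounitalHopfBimodule.{u}) : B.M →ₗ[ℂ] ℂ :=
  regularTrace B.t.range ∘ₗ
    { toFun := fun x => (⟨B.targetCounit x, B.targetCounit_mem x⟩ : B.t.range)
      map_add' := fun x y => Subtype.ext (map_add B.targetCounit x y)
      map_smul' := fun c x => Subtype.ext (map_smul B.targetCounit c x) }

/-- A Kac bimodule: a counital Hopf bimodule such that `(id ⊗ ε) ∘ Δ = id`. -/
structure KacBimodule extends CounitalHopfBimodule.{u} where
  comul_counit : ∀ x, TensorProduct.rid ℂ M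
    (TensorProduct.map LinearMap.id toCounitalHopfBimodule.counit
      (toHopfBimodule.comulLin x)) = x

/-- A morphism of Kac bimodules: an isomorphism of the bases (relative tensor products and
fibered products of maps are taken over one base, up to isomorphism) together with a unital
*-homomorphism of the total algebras that respect `t`, `Δ` and `S` (hence also `s`). -/
@[ext]
structure KacBimodule.Hom (B B' : KacBimodule.{u}) where
  /-- the isomorphism of the bases -/
  base : B.N ≃⋆ₐ[ℂ] B'.N
  /-- the homomorphism of the total algebras -/
  total : B.M →⋆ₐ[ℂ] B'.M
  map_t : ∀ n, total (B.t n) = B'.t (base n)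
  map_comul : ∀ x, TensorProduct.map (total : B.M →ₗ[ℂ] B'.M) (total : B.M →ₗ[ℂ] B'.M)
    (B.comulLin x) = B'.comulLin (total x)
  map_S : ∀ x, total (B.S x) = B'.S (total x)

instance : CategoryTheory.Category KacBimodule.{u} where
  Hom := KacBimodule.Hom
  id B :=
    { base := StarAlgEquiv.refl ℂ B.N
      total := StarAlgHom.id ℂ B.M
      map_t := fun _ => rfl
      map_comul := fun x => by
        have : ((StarAlgHom.id ℂ B.M : B.M →⋆ₐ[ℂ] B.M) : B.M →ₗ[ℂ] B.M) = LinearMap.id := rfl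
        rw [this, TensorProduct.map_id]; rfl
      map_S := fun _ => rfl }
  comp {B B' B''} f g :=
    { base := f.base.trans g.base
      total := g.total.comp f.total
      map_t := fun n => by simp [f.map_t, g.map_t]
      map_comul := fun x => by
        have : ((g.total.comp f.total : B.M →⋆ₐ[ℂ] B''.M) : B.M →ₗ[ℂ] B''.M) =
          (g.total : B'.M →ₗ[ℂ] B''.M) ∘ₗ (f.total : B.M →ₗ[ℂ] B'.M) := rfl
        rw [this, TensorProduct.map_comp, LinearMap.comp_apply, f.map_comul, g.map_comul]
        rfl
      map_S := fun x => by simp [f.map_S, g.map_S] }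

/-! ### Weak Kac algebras -/

/-- A generalized coinvolutive C*-bialgebra `(M, Δ, S)`; `Δ` need not be unital. -/
structure GenCoinvolutiveCStarBialgebra where
  /-- the underlying C*-algebra -/
  M : Type u
  [cstarM : CStarAlgebra M]
  [finM : FiniteDimensional ℂ M]
  /-- the coproduct -/
  comul : M →⋆ₙₐ[ℂ] M ⊗[ℂ] M
  comul_injective : Function.Injective comul
  coassoc : ∀ x,
    TensorProduct.assoc ℂ M M M
        (TensorProduct.map (comul : M →ₗ[ℂ] M ⊗[ℂ] M) LinearMap.id (comul x)) =
      TensorProduct.map LinearMap.id (comul : M →ₗ[ℂ] M ⊗[ℂ] M) (comul x)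
  /-- the coinvolution -/
  S : AntiStarHom M M
  S_S : ∀ x, S (S x) = x
  S_comul : ∀ x, TensorProduct.map S.toLinearMap S.toLinearMap (comul x) =
    TensorProduct.comm ℂ M M (comul (S x))

attribute [instance] GenCoinvolutiveCStarBialgebra.cstarM GenCoinvolutiveCStarBialgebra.finM

/-- The source counital map `ε_s = μ ∘ (S ⊗ id) ∘ Δ`. -/
def GenCoinvolutiveCStarBialgebra.sourceCounit (A : GenCoinvolutiveCStarBialgebra.{u}) :
    A.M →ₗ[ℂ] A.M :=
  LinearMap.mul' ℂ A.M ∘ₗ TensorProduct.map A.S.toLinearMap LinearMap.id ∘ₗ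
    (A.comul : A.M →ₗ[ℂ] A.M ⊗[ℂ] A.M)

/-- A weak Kac algebra `(M, Δ, S, ε)`. -/
structure WeakKacAlgebra extends GenCoinvolutiveCStarBialgebra.{u} where
  /-- the counit -/
  counit : M →ₗ[ℂ] ℂ
  counit_comul : ∀ x, TensorProduct.lid ℂ M
    (TensorProduct.map counit LinearMap.id (comul x)) = x
  comul_counit : ∀ x, TensorProduct.rid ℂ M
    (TensorProduct.map LinearMap.id counit (comul x)) = x
  counit_S : ∀ x, counit (S x) = counit x
  counit_star : ∀ x, counit (star x) = star (counit x)
  /-- `(ε ⊗ ε)((x ⊗ 1) Δ(1) (1 ⊗ y)) = ε(xy)` -/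
  counit_mul : ∀ x y, LinearMap.mul' ℂ ℂ
    (TensorProduct.map counit counit ((x ⊗ₜ 1) * comul 1 * (1 ⊗ₜ y))) = counit (x * y)
  /-- `(ε_s ⊗ id) Δ(x) = (1 ⊗ x) Δ(1)` -/
  sourceCounit_comul : ∀ x,
    TensorProduct.map toGenCoinvolutiveCStarBialgebra.sourceCounit LinearMap.id (comul x) =
      (1 ⊗ₜ x) * comul 1

/-- A homomorphism of weak Kac algebras. -/
@[ext]
structure WeakKacAlgebra.Hom (A A' : WeakKacAlgebra.{u}) where
  /-- the underlying unital *-homomorphism -/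
  total : A.M →⋆ₐ[ℂ] A'.M
  map_comul : ∀ x, TensorProduct.map (total : A.M →ₗ[ℂ] A'.M) (total : A.M →ₗ[ℂ] A'.M)
    (A.comul x) = A'.comul (total x)
  map_S : ∀ x, total (A.S x) = A'.S (total x)
  map_counit : ∀ x, A'.counit (total x) = A.counit x

instance : CategoryTheory.Category WeakKacAlgebra.{u} where
  Hom := WeakKacAlgebra.Hom
  id A :=
    { total := StarAlgHom.id ℂ A.M
      map_comul := fun x => by
        have : ((StarAlgHom.id ℂ A.M : A.M →⋆ₐ[ℂ] A.M) : A.M →ₗ[ℂ] A.M) = LinearMap.id := rfl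
        rw [this, TensorProduct.map_id]; rfl
      map_S := fun _ => rfl
      map_counit := fun _ => rfl }
  comp {A A' A''} f g :=
    { total := g.total.comp f.total
      map_comul := fun x => by
        have : ((g.total.comp f.total : A.M →⋆ₐ[ℂ] A''.M) : A.M →ₗ[ℂ] A''.M) =
          (g.total : A'.M →ₗ[ℂ] A''.M) ∘ₗ (f.total : A.M →ₗ[ℂ] A'.M) := rfl
        rw [this, TensorProduct.map_comp, LinearMap.comp_apply, f.map_comul, g.map_comul]
        rfl
      map_S := fun x => by simp [f.map_S, g.map_S]
      map_counit := fun x => by simp [f.map_counit, g.map_counit] }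

end

/-! ### The regular trace and the separability element of a finite-dimensional C*-algebra -/

/-! The bridge between the two structures is the separability idempotent of the base. Let θ be the
trace of the left regular representation of N. It is a faithful positive trace, so N has a basis
(bᵢ) orthonormal for θ(x* y). Computing the trace of left multiplication in this basis gives θ(m) =
θ(m ∑ bᵢ* bᵢ), hence ∑ bᵢ* bᵢ = 1 by faithfulness. Thus ∑ bᵢ* ⊗ bᵢ is a symmetric separability
element, and its image ∑ s(bᵢ*) ⊗ t(bᵢ) is exactly e_{s,t} (`IsRegularBasis.fiberProjection_eq`).

For a Kac bimodule, Δ(1) = e_{s,t} is therefore explicit. Expanding ε_t in the basis bᵢ turns (id ⊗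
ε)Δ = id into (id ⊗ ε_t)Δ(x) = Δ(1)(x ⊗ 1), and S carries this to the identity for ε_s. Uniqueness
of counits gives invariance of ε under S and *, and weak multiplicativity follows from ε(x ε_t(y)) =
ε(xy).

The functor is faithful because t is injective. It is full because a morphism π of weak Kac algebras
maps t(N) into t'(N'). The induced map g of bases is injective since ε ∘ t = θ is faithful, and
surjective since (π ⊗ π)Δ(1) = Δ'(1), whose right leg spans t'(N').

For essential surjectivity, the base is N = ε_t(M). The weak Kac axioms force Δ(1) ∈ S(N) ⊗ N and
Δ(1) = e_{s,t} (`WeakKacAlgebra.comul_one_eq_fiberProjection`). Writing Δ(1) = ∑ S(aᵢ) ⊗ cᵢ, one has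
n = ∑ ε(n aᵢ) cᵢ on N and ∑ cᵢ aᵢ = 1, so the regular trace of N is ε restricted to N
(`WeakKacAlgebra.regularTrace_base`). Hence θ ∘ ε_t returns the original counit. -/

theorem regularTrace_algEquiv {A B : Type*} [Ring A] [Algebra ℂ A] [Ring B] [Algebra ℂ B]
    (e : A ≃ₐ[ℂ] B) (x : A) : regularTrace B (e x) = regularTrace A x := by
  have h : LinearMap.mul ℂ B (e x) = e.toLinearEquiv.conj (LinearMap.mul ℂ A x) := by
    ext y
    simp [LinearEquiv.conj_apply]
  simp only [regularTrace, LinearMap.comp_apply]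
  rw [h, LinearMap.trace_conj']

theorem regularTrace_mul_comm {A : Type*} [Ring A] [Algebra ℂ A] (x y : A) :
    regularTrace A (x * y) = regularTrace A (y * x) := by
  have h : ∀ a b : A, LinearMap.mul ℂ A (a * b) = LinearMap.mul ℂ A a * LinearMap.mul ℂ A b := by
    intro a b
    ext z
    simp [mul_assoc]
  simp only [regularTrace, LinearMap.comp_apply, h]
  exact LinearMap.trace_mul_comm ℂ _ _

/-- If `n = ∑ φ(n aₖ) cₖ` for all `n`, then the regular trace of `m` is `∑ φ(m cₖ aₖ)`. -/
theorem regularTrace_eq_of_reproducing {A ι : Type*} [Ring A] [Algebra ℂ A] [FiniteDimensional ℂ A]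
    [Fintype ι] (φ : A →ₗ[ℂ] ℂ) (a c : ι → A) (h : ∀ n, n = ∑ k, φ (n * a k) • c k) (m : A) :
    regularTrace A m = φ (m * ∑ k, c k * a k) := by
  -- Left multiplication by m is a sum of the rank-one operators n ↦ φ(m n aₖ) cₖ, whose traces are
  -- φ(m cₖ aₖ).
  have e : LinearMap.mul ℂ A m =
      ∑ k, (φ ∘ₗ LinearMap.mulRight ℂ (a k) ∘ₗ LinearMap.mulLeft ℂ m).smulRight (c k) := by
    ext n
    simpa [mul_assoc] using h (m * n)
  simp only [regularTrace, LinearMap.comp_apply]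
  rw [e, map_sum, Finset.mul_sum, map_sum]
  refine Finset.sum_congr rfl fun k _ => ?_
  rw [LinearMap.trace_smulRight]
  simp [mul_assoc]

/-- A basis of `A` which is orthonormal for `⟨x, y⟩ = θ(x* y)`, where `θ` is the regular trace. -/
structure IsRegularBasis {A ι : Type*} [Ring A] [StarRing A] [Algebra ℂ A] [Fintype ι]
    (b : ι → A) : Prop where
  expand : ∀ x, x = ∑ i, regularTrace A (star (b i) * x) • b i
  expand_star : ∀ x, x = ∑ i, regularTrace A (x * b i) • star (b i)

theorem exists_isRegularBasis (A : Type*) [CStarAlgebra A] [FiniteDimensional ℂ A] :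
    ∃ b : Fin (Module.finrank ℂ A) → A, IsRegularBasis b := by
  have hA := FaithfulFunctional.regularTrace_isFaithfulPositive A
  obtain ⟨b, hb⟩ := FaithfulFunctional.exists_orthonormal_basis hA.core
  have hb' : ∀ i j, regularTrace A (star (b i) * b j) = if i = j then 1 else 0 := hb
  have h1 : ∀ x, x = ∑ i, regularTrace A (star (b i) * x) • b i := by
    intro x
    have hx : ∀ i, regularTrace A (star (b i) * x) = b.repr x i := by
      intro i
      conv_lhs => rw [← b.sum_repr x]
      simp [Finset.mul_sum, hb', -Module.Basis.sum_repr]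
    simp only [hx]
    exact (b.sum_repr x).symm
  refine ⟨b, h1, fun x => ?_⟩
  have h2 := congrArg star (h1 (star x))
  rw [star_star, star_sum] at h2
  rw [h2]
  refine Finset.sum_congr rfl fun i _ => ?_
  rw [star_smul, ← hA.map_star, star_mul, star_star, star_star, ← h2]

namespace IsRegularBasis

variable {A ι : Type*} [CStarAlgebra A] [Fintype ι] {b : ι → A}

/-- The reproducing formula gives θ(m) = θ(m ∑ bᵢ* bᵢ) for every m, and θ is faithful. This
normalization is special to the regular trace among the traces. -/
theorem sum_star_mul_self [FiniteDimensional ℂ A] (hb : IsRegularBasis b) : ∑ i, star (b i) * b i = 1 := by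
  have hA := FaithfulFunctional.regularTrace_isFaithfulPositive A
  rw [← sub_eq_zero]
  apply hA.definite
  rw [mul_sub, map_sub, ← regularTrace_eq_of_reproducing _ _ _ hb.expand_star, mul_one, sub_self]

/-- Both sides have coefficient θ(x bᵢ* bⱼ) at bⱼ* ⊗ bᵢ, the second one by traciality. -/
theorem sum_mul_tmul (hb : IsRegularBasis b) (x : A) :
    ∑ i, (x * star (b i)) ⊗ₜ[ℂ] b i = ∑ i, star (b i) ⊗ₜ[ℂ] (b i * x) := by
  have h1 : ∀ i, (x * star (b i)) ⊗ₜ[ℂ] b i =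
      ∑ j, regularTrace A (x * star (b i) * b j) • (star (b j) ⊗ₜ[ℂ] b i) := fun i => by
    conv_lhs => rw [hb.expand_star (x * star (b i))]
    simp only [TensorProduct.sum_tmul, TensorProduct.smul_tmul']
  have h2 : ∀ j, star (b j) ⊗ₜ[ℂ] (b j * x) =
      ∑ i, regularTrace A (x * star (b i) * b j) • (star (b j) ⊗ₜ[ℂ] b i) := fun j => by
    conv_lhs => rw [hb.expand (b j * x)]
    simp only [TensorProduct.tmul_sum, TensorProduct.tmul_smul]
    refine Finset.sum_congr rfl fun i _ => ?_
    rw [← mul_assoc, regularTrace_mul_comm, ← mul_assoc]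
  simp only [h1, h2]
  exact Finset.sum_comm

theorem sum_tmul_comm (hb : IsRegularBasis b) :
    ∑ i, b i ⊗ₜ[ℂ] star (b i) = ∑ i, star (b i) ⊗ₜ[ℂ] b i := by
  have h1 : ∀ i, b i ⊗ₜ[ℂ] star (b i) =
      ∑ j, regularTrace A (b i * b j) • (star (b j) ⊗ₜ[ℂ] star (b i)) := fun i => by
    have := congrArg (· ⊗ₜ[ℂ] star (b i)) (hb.expand_star (b i))
    simpa only [TensorProduct.sum_tmul, TensorProduct.smul_tmul'] using this
  have h2 : ∀ j, star (b j) ⊗ₜ[ℂ] b j =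
      ∑ i, regularTrace A (b i * b j) • (star (b j) ⊗ₜ[ℂ] star (b i)) := fun j => by
    have := congrArg (star (b j) ⊗ₜ[ℂ] ·) (hb.expand_star (b j))
    simpa only [TensorProduct.tmul_sum, TensorProduct.tmul_smul, regularTrace_mul_comm (b j)]
      using this
  simp only [h1, h2]
  exact Finset.sum_comm

end IsRegularBasis

namespace AntiStarHom

variable {A B : Type*} [Ring A] [StarRing A] [Algebra ℂ A] [Ring B] [StarRing B] [Algebra ℂ B]

theorem map_one (f : AntiStarHom A B) : f 1 = 1 := f.map_one'

theorem map_mul (f : AntiStarHom A B) (x y : A) : f (x * y) = f y * f x := f.map_mul' x y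

theorem map_star (f : AntiStarHom A B) (x : A) : f (star x) = star (f x) := f.map_star' x

end AntiStarHom

/-! ### The fiber projection as a separability idempotent -/

theorem IsRegularBasis.fiberProjection_eq {N M₁ M₂ ι : Type*} [CStarAlgebra N] [CStarAlgebra M₁]
    [CStarAlgebra M₂] [FiniteDimensional ℂ N] [FiniteDimensional ℂ M₁] [FiniteDimensional ℂ M₂]
    [Fintype ι] {b : ι → N} (hb : IsRegularBasis b) (β : AntiStarHom N M₁) (γ : N →⋆ₐ[ℂ] M₂) :
    fiberProjection β γ = ∑ i, β (star (b i)) ⊗ₜ[ℂ] γ (b i) := by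
  have htransfer := fun {x y : N ⊗[ℂ] N} (h : x = y) =>
    congrArg (TensorProduct.map β.toLinearMap (γ : N →ₗ[ℂ] M₂)) h
  -- As β reverses products, separability in N becomes a balancing on the right, so that this
  -- element kills the relations.
  have hbal : ∀ n, (∑ i, β (star (b i)) ⊗ₜ[ℂ] γ (b i)) * (β n ⊗ₜ 1) =
      (∑ i, β (star (b i)) ⊗ₜ[ℂ] γ (b i)) * (1 ⊗ₜ γ n) := fun n => by
    simpa [Finset.sum_mul, AntiStarHom.map_mul] using htransfer (hb.sum_mul_tmul n)
  symm
  refine eq_fiberProjection β γ _ ⟨?_, ?_⟩ fun x => ?_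
  · have h : ∀ j, (∑ i, β (star (b i)) ⊗ₜ[ℂ] γ (b i)) * (β (star (b j)) ⊗ₜ γ (b j)) =
        ∑ i, β (star (b i)) ⊗ₜ[ℂ] (γ (b i) * γ (star (b j) * b j)) := fun j => by
      have : β (star (b j)) ⊗ₜ[ℂ] γ (b j) = (β (star (b j)) ⊗ₜ 1) * (1 ⊗ₜ γ (b j)) := by simp
      rw [this, ← mul_assoc, hbal, mul_assoc]
      simp [Finset.sum_mul]
    rw [IsIdempotentElem]
    conv_lhs => rw [Finset.mul_sum]
    simp only [h]
    rw [Finset.sum_comm]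
    refine Finset.sum_congr rfl fun i _ => ?_
    rw [← TensorProduct.tmul_sum, ← Finset.mul_sum, ← map_sum, hb.sum_star_mul_self]
    simp
  · rw [IsSelfAdjoint]
    simpa [← AntiStarHom.map_star, ← map_star] using htransfer hb.sum_tmul_comm
  · rw [RelativeTensor.mk, Submodule.mkQ_apply, Submodule.Quotient.mk_eq_zero]
    constructor
    · intro hx
      -- Inserting 1 = ∑ γ(bᵢ* bᵢ) in the second leg and moving bᵢ* to the first leg changes x only
      -- by relations.
      have h : x - (∑ i, β (star (b i)) ⊗ₜ[ℂ] γ (b i)) * x ∈ balancedRelations β γ := by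
        clear hx
        induction x with
        | zero => simp
        | add x y hx hy =>
          rw [mul_add, add_sub_add_comm]
          exact add_mem hx hy
        | tmul ζ η =>
          have e : ζ ⊗ₜ[ℂ] η - (∑ i, β (star (b i)) ⊗ₜ[ℂ] γ (b i)) * (ζ ⊗ₜ η) =
              - ∑ i, ((β (star (b i)) * ζ) ⊗ₜ[ℂ] (γ (b i) * η) -
                ζ ⊗ₜ[ℂ] (γ (star (b i)) * (γ (b i) * η))) := by
            rw [Finset.sum_sub_distrib, ← TensorProduct.tmul_sum]
            simp only [← mul_assoc, ← map_mul]
            rw [← Finset.sum_mul, ← map_sum, hb.sum_star_mul_self]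
            simp [Finset.sum_mul]
          rw [e]
          exact neg_mem (sum_mem fun i _ => Submodule.subset_span ⟨_, _, _, rfl⟩)
      rwa [hx, sub_zero] at h
    · intro hx
      induction hx using Submodule.span_induction with
      | mem x h =>
        obtain ⟨n, ζ, η, rfl⟩ := h
        have e1 : (β n * ζ) ⊗ₜ[ℂ] η = (β n ⊗ₜ 1) * (ζ ⊗ₜ η) := by simp
        have e2 : ζ ⊗ₜ[ℂ] (γ n * η) = (1 ⊗ₜ γ n) * (ζ ⊗ₜ η) := by simp
        rw [mul_sub, e1, e2, ← mul_assoc, ← mul_assoc, hbal, sub_self]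
      | zero => simp
      | add x y _ _ hx hy => rw [mul_add, hx, hy, add_zero]
      | smul c x _ hx => rw [mul_smul_comm, hx, smul_zero]

/-! ### Coinvolutions and counits -/

section Coinvolution

variable {M : Type*} [Ring M] [StarRing M] [Algebra ℂ M]

/-- The map `ς ∘ (S ⊗ S)` of `M ⊗ M`. -/
noncomputable def AntiStarHom.flip (S : AntiStarHom M M) : M ⊗[ℂ] M →ₗ[ℂ] M ⊗[ℂ] M :=
  (TensorProduct.comm ℂ M M).toLinearMap ∘ₗ TensorProduct.map S.toLinearMap S.toLinearMap

namespace AntiStarHom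

variable (S : AntiStarHom M M)

@[simp]
theorem flip_tmul (x y : M) : S.flip (x ⊗ₜ y) = S y ⊗ₜ S x := rfl

theorem flip_mul (z w : M ⊗[ℂ] M) : S.flip (z * w) = S.flip w * S.flip z := by
  induction z with
  | zero => simp
  | add a b ha hb => rw [add_mul, map_add, ha, hb, map_add, mul_add]
  | tmul a b =>
    induction w with
    | zero => simp
    | add c d hc hd => rw [mul_add, map_add, hc, hd, map_add, add_mul]
    | tmul c d => simp [S.map_mul]

theorem map_id_flip {f g : M →ₗ[ℂ] M} (h : ∀ x, g (S x) = S (f x)) (z : M ⊗[ℂ] M) :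
    TensorProduct.map g LinearMap.id (S.flip z) =
      S.flip (TensorProduct.map LinearMap.id f z) := by
  induction z with
  | zero => simp
  | add a b ha hb => simp only [map_add, ha, hb]
  | tmul a b => simp [h]

theorem id_map_flip {f g : M →ₗ[ℂ] M} (h : ∀ x, g (S x) = S (f x)) (z : M ⊗[ℂ] M) :
    TensorProduct.map LinearMap.id g (S.flip z) =
      S.flip (TensorProduct.map f LinearMap.id z) := by
  induction z with
  | zero => simp
  | add a b ha hb => simp only [map_add, ha, hb]
  | tmul a b => simp [h]

theorem mul_map_id_flip (z : M ⊗[ℂ] M) :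
    LinearMap.mul' ℂ M (TensorProduct.map S.toLinearMap LinearMap.id (S.flip z)) =
      S (LinearMap.mul' ℂ M (TensorProduct.map LinearMap.id S.toLinearMap z)) := by
  induction z with
  | zero => simp
  | add a b ha hb => simp only [map_add, ha, hb]
  | tmul a b => simp [S.map_mul]

theorem comul_apply {Δ : M →ₗ[ℂ] M ⊗[ℂ] M} (h : ∀ x, TensorProduct.map S.toLinearMap S.toLinearMap
    (Δ x) = TensorProduct.comm ℂ M M (Δ (S x))) (x : M) : Δ (S x) = S.flip (Δ x) := by
  rw [flip, LinearMap.comp_apply, h]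
  exact ((TensorProduct.comm ℂ M M).symm_apply_apply _).symm

end AntiStarHom

/-- Evaluate f ⊗ g on Δ(x) in both orders: a left counit and a right counit always agree. -/
theorem counit_unique {M : Type*} [AddCommGroup M] [Module ℂ M] {Δ : M →ₗ[ℂ] M ⊗[ℂ] M}
    {f g : M →ₗ[ℂ] ℂ}
    (hf : ∀ x, TensorProduct.lid ℂ M (TensorProduct.map f LinearMap.id (Δ x)) = x)
    (hg : ∀ x, TensorProduct.rid ℂ M (TensorProduct.map LinearMap.id g (Δ x)) = x) (x : M) :
    f x = g x := by
  have key : ∀ z : M ⊗[ℂ] M, f (TensorProduct.rid ℂ M (TensorProduct.map LinearMap.id g z)) =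
      g (TensorProduct.lid ℂ M (TensorProduct.map f LinearMap.id z)) := fun z => by
    induction z with
    | zero => simp
    | add a b ha hb => simp only [map_add, ha, hb]
    | tmul a b => simp [mul_comm]
  conv_lhs => rw [← hg x]
  conv_rhs => rw [← hf x]
  exact key _

variable [StarModule ℂ M]

/-- The functional `x ↦ conj (φ (x*))`. -/
def conjFunctional (φ : M →ₗ[ℂ] ℂ) : M →ₗ[ℂ] ℂ where
  toFun x := star (φ (star x))
  map_add' x y := by simp
  map_smul' c x := by simp

theorem rid_map_conjFunctional (φ : M →ₗ[ℂ] ℂ) (z : M ⊗[ℂ] M) :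
    TensorProduct.rid ℂ M (TensorProduct.map LinearMap.id (conjFunctional φ) z) =
      star (TensorProduct.rid ℂ M (TensorProduct.map LinearMap.id φ (star z))) := by
  induction z with
  | zero => simp
  | add a b ha hb => simp only [map_add, star_add, ha, hb]
  | tmul a b => simp [conjFunctional, star_smul]

omit [StarModule ℂ M] in
-- This makes φ ∘ S a left counit whenever φ is a right counit.
theorem lid_map_flip (S : AntiStarHom M M) (hS : ∀ x, S (S x) = x) (φ : M →ₗ[ℂ] ℂ)
    (z : M ⊗[ℂ] M) :
    TensorProduct.lid ℂ M (TensorProduct.map (φ ∘ₗ S.toLinearMap) LinearMap.id (S.flip z)) =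
      S (TensorProduct.rid ℂ M (TensorProduct.map LinearMap.id φ z)) := by
  induction z with
  | zero => simp
  | add a b ha hb => simp only [map_add, ha, hb]
  | tmul a b => simp [hS]

end Coinvolution

/-! ### From Kac bimodules to weak Kac algebras -/

namespace HopfBimodule

variable (B : HopfBimodule.{u})

theorem comulTensor_one : B.comulTensor 1 = fiberProjection B.s B.t := by
  simp only [comulTensor, NonUnitalStarAlgHom.comp_apply]
  have : B.comul.toNonUnitalStarAlgHom 1 = 1 := _root_.map_one B.comul
  rw [this]
  rfl

theorem comulTensor_t_mul (n : B.N) (x : B.M) :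
    B.comulTensor (B.t n * x) = (B.t n ⊗ₜ 1) * B.comulTensor x := by
  have h : B.comulTensor (B.t n) = (B.t n ⊗ₜ 1) * B.comulTensor 1 := by
    rw [comulTensor_one]
    exact B.comul_t n
  rw [_root_.map_mul, h, mul_assoc, ← _root_.map_mul, one_mul]

theorem comulTensor_s_mul (n : B.N) (x : B.M) :
    B.comulTensor (B.s n * x) = (1 ⊗ₜ B.s n) * B.comulTensor x := by
  have h : B.comulTensor (B.s n) = (1 ⊗ₜ B.s n) * B.comulTensor 1 := by
    rw [comulTensor_one]
    exact B.comul_s n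
  rw [_root_.map_mul, h, mul_assoc, ← _root_.map_mul, one_mul]

end HopfBimodule

namespace CounitalHopfBimodule

variable (B : CounitalHopfBimodule.{u})

/-- Since t identifies N with t(N), the counit can be computed with the regular trace of N itself.
-/
theorem counit_eq {x : B.M} {n : B.N} (h : B.targetCounit x = B.t n) :
    B.counit x = regularTrace B.N n := by
  rw [← regularTrace_algEquiv (StarAlgEquiv.ofInjective B.t B.t_injective).toAlgEquiv n]
  exact congrArg (regularTrace B.t.range) (Subtype.ext h)

theorem targetCounit_t_mul (n : B.N) (x : B.M) :
    B.targetCounit (B.t n * x) = B.t n * B.targetCounit x := by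
  have := B.targetCounit_bimodule n 1 x
  simpa [AntiStarHom.map_one] using this

theorem targetCounit_s_mul (n : B.N) (x : B.M) :
    B.targetCounit (B.s n * x) = B.targetCounit x * B.t n := by
  have := B.targetCounit_bimodule 1 n x
  simpa using this

theorem targetCounit_t (n : B.N) : B.targetCounit (B.t n) = B.t n := by
  have := B.targetCounit_t_mul n 1
  rwa [mul_one, B.targetCounit_one, mul_one] at this

theorem counit_t (n : B.N) : B.counit (B.t n) = regularTrace B.N n :=
  B.counit_eq (B.targetCounit_t n)

theorem counit_t_mul {x : B.M} {m : B.N} (h : B.targetCounit x = B.t m) (n : B.N) :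
    B.counit (B.t n * x) = regularTrace B.N (n * m) :=
  B.counit_eq (by rw [B.targetCounit_t_mul, h, _root_.map_mul])

theorem counit_s_mul {x : B.M} {m : B.N} (h : B.targetCounit x = B.t m) (n : B.N) :
    B.counit (B.s n * x) = regularTrace B.N (m * n) :=
  B.counit_eq (by rw [B.targetCounit_s_mul, h, _root_.map_mul])

/-- If ε_t(x) = t(m), the coefficient θ(bᵢ* m) of m is ε(s(bᵢ*) x). Thus ε_t is recovered from ε
alone. -/
theorem targetCounit_eq_sum {ι : Type*} [Fintype ι] {b : ι → B.N} (hb : IsRegularBasis b)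
    (x : B.M) :
    B.targetCounit x = ∑ i, B.counit (B.s (star (b i)) * x) • B.t (b i) := by
  obtain ⟨m, hm⟩ := B.targetCounit_mem x
  have hm' : B.targetCounit x = B.t m := hm.symm
  simp only [B.counit_s_mul hm', regularTrace_mul_comm m]
  rw [hm']
  conv_lhs => rw [hb.expand m]
  simp

/-- `(id ⊗ ε_t) Δ(x) = Δ(1) (x ⊗ 1)` for a bimodule with `(id ⊗ ε) Δ = id`. -/
theorem map_targetCounit_comul (h : ∀ x, TensorProduct.rid ℂ B.M
    (TensorProduct.map LinearMap.id B.counit (B.comulLin x)) = x) (x : B.M) :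
    TensorProduct.map LinearMap.id B.targetCounit (B.comulTensor x) =
      B.comulTensor 1 * (x ⊗ₜ 1) := by
  obtain ⟨b, hb⟩ := exists_isRegularBasis B.N
  -- At z = Δ(x) the factor 1 ⊗ s(bᵢ*) is absorbed into Δ(s(bᵢ*) x), and the counit property leaves
  -- s(bᵢ*) x in the first leg.
  have key : ∀ z : B.M ⊗[ℂ] B.M, TensorProduct.map LinearMap.id B.targetCounit z =
      ∑ i, (TensorProduct.rid ℂ B.M (TensorProduct.map LinearMap.id B.counit
        ((1 ⊗ₜ B.s (star (b i))) * z))) ⊗ₜ[ℂ] B.t (b i) := fun z => by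
    induction z with
    | zero => simp
    | add a b ha hb =>
      simp only [map_add, mul_add, ha, hb, TensorProduct.add_tmul, Finset.sum_add_distrib]
    | tmul p q =>
      simp [B.targetCounit_eq_sum hb, TensorProduct.tmul_sum, TensorProduct.smul_tmul']
  rw [key, B.comulTensor_one, hb.fiberProjection_eq, Finset.sum_mul]
  refine Finset.sum_congr rfl fun i _ => ?_
  rw [← B.comulTensor_s_mul]
  have := h (B.s (star (b i)) * x)
  rw [HopfBimodule.comulLin] at this
  erw [this]
  simp

end CounitalHopfBimodule

namespace CoinvolutiveHopfBimodule

variable (B : CoinvolutiveHopfBimodule.{u})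

theorem comulTensor_S (x : B.M) : B.comulTensor (B.S x) = B.S.flip (B.comulTensor x) :=
  B.S.comul_apply (Δ := B.comulLin) B.S_comul x

/-- The source counital map `ε_s = μ ∘ (S ⊗ id) ∘ Δ`. -/
noncomputable def sourceCounit : B.M →ₗ[ℂ] B.M :=
  LinearMap.mul' ℂ B.M ∘ₗ TensorProduct.map B.S.toLinearMap LinearMap.id ∘ₗ B.comulLin

theorem sourceCounit_S (x : B.M) : B.sourceCounit (B.S x) = B.S (B.targetCounit x) := by
  have : B.comulLin (B.S x) = B.S.flip (B.comulLin x) := B.comulTensor_S x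
  simp only [sourceCounit, LinearMap.comp_apply, this, AntiStarHom.mul_map_id_flip]
  rfl

/-- As S reverses products, the legs of Δ(y) meet in the middle: x₁ y₁ S(y₂) S(x₂) = x₁ ε_t(y)
S(x₂). -/
theorem targetCounit_mul (x y : B.M) :
    B.targetCounit (x * y) = LinearMap.mul' ℂ B.M (TensorProduct.map LinearMap.id
      B.S.toLinearMap (B.comulTensor x * (B.targetCounit y ⊗ₜ 1))) := by
  have key : ∀ z w : B.M ⊗[ℂ] B.M,
      LinearMap.mul' ℂ B.M (TensorProduct.map LinearMap.id B.S.toLinearMap (z * w)) =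
      LinearMap.mul' ℂ B.M (TensorProduct.map LinearMap.id B.S.toLinearMap
        (z * (LinearMap.mul' ℂ B.M (TensorProduct.map LinearMap.id B.S.toLinearMap w) ⊗ₜ 1))) := by
    intro z w
    induction z with
    | zero => simp
    | add a b ha hb => simp only [map_add, add_mul, ha, hb]
    | tmul a b =>
      induction w with
      | zero => simp
      | add c d hc hd => simp only [map_add, mul_add, TensorProduct.add_tmul, hc, hd]
      | tmul c d => simp [B.S.map_mul, mul_assoc]
  have : B.targetCounit (x * y) = LinearMap.mul' ℂ B.M (TensorProduct.map LinearMap.id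
      B.S.toLinearMap (B.comulTensor x * B.comulTensor y)) := by
    rw [← _root_.map_mul]
    rfl
  rw [this, key]
  rfl

end CoinvolutiveHopfBimodule

namespace CounitalHopfBimodule

variable (B : CounitalHopfBimodule.{u})

theorem targetCounit_mul_targetCounit (x y : B.M) :
    B.targetCounit (x * B.targetCounit y) = B.targetCounit (x * y) := by
  obtain ⟨m, hm⟩ := B.targetCounit_mem y
  have hm' : B.targetCounit y = B.t m := hm.symm
  rw [B.targetCounit_mul x y, B.targetCounit_mul, hm', B.targetCounit_t]

theorem counit_congr {x y : B.M} (h : B.targetCounit x = B.targetCounit y) :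
    B.counit x = B.counit y := by
  obtain ⟨m, hm⟩ := B.targetCounit_mem y
  rw [B.counit_eq hm.symm, B.counit_eq (h.trans hm.symm)]

end CounitalHopfBimodule

/-! ### The counit axioms for a Kac bimodule -/

namespace KacBimodule

variable (B : KacBimodule.{u})

/-- ε ∘ S is a left counit and ε a right one, so they coincide. -/
theorem counit_S (x : B.M) : B.counit (B.S x) = B.counit x := by
  refine counit_unique (Δ := B.comulLin) (f := B.counit ∘ₗ B.S.toLinearMap) (fun y => ?_)
    B.comul_counit x
  have h := lid_map_flip B.S B.S_S B.counit (B.comulLin (B.S y))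
  rw [B.comul_counit, B.S_S] at h
  have h2 : B.comulLin (B.S (B.S y)) = B.S.flip (B.comulLin (B.S y)) := B.comulTensor_S _
  rw [← h2, B.S_S] at h
  exact h

theorem counit_comul (x : B.M) : TensorProduct.lid ℂ B.M
    (TensorProduct.map B.counit LinearMap.id (B.comulLin x)) = x := by
  have h := lid_map_flip B.S B.S_S B.counit (B.comulLin (B.S x))
  have h2 : B.comulLin (B.S (B.S x)) = B.S.flip (B.comulLin (B.S x)) := B.comulTensor_S _
  have h3 : B.counit ∘ₗ B.S.toLinearMap = B.counit := LinearMap.ext B.counit_S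
  rwa [B.comul_counit, B.S_S, ← h2, B.S_S, h3] at h

theorem counit_star (x : B.M) : B.counit (star x) = star (B.counit x) := by
  have h := counit_unique (Δ := B.comulLin) (g := conjFunctional B.counit) B.counit_comul
    (fun y => ?_) x
  · rw [h]
    exact (star_star _).symm
  · have h2 : star (B.comulLin y) = B.comulLin (star y) :=
      (StarHomClass.map_star B.comulTensor y).symm
    rw [rid_map_conjFunctional, h2, B.comul_counit, star_star]

/-- After applying S, the two sides are θ(nm) and θ(mn), where ε_t(S(x)) = t(m). -/
theorem counit_mul_s (x : B.M) (n : B.N) : B.counit (x * B.s n) = B.counit (x * B.t n) := by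
  obtain ⟨m, hm⟩ := B.targetCounit_mem (B.S x)
  have h1 : B.S (B.s n) = B.t n := by rw [← B.S_t, B.S_S]
  rw [← B.counit_S (x * B.s n), ← B.counit_S (x * B.t n), B.S.map_mul, B.S.map_mul, h1, B.S_t,
    B.counit_t_mul hm.symm, B.counit_s_mul hm.symm, regularTrace_mul_comm]

/-- With ε_t(y) = t(m), ε(xy) = ε(x t(m)) = ε(x s(m)). Expanding m along bᵢ* with coefficients θ(m
bᵢ) = ε(t(bᵢ) y) reproduces Δ(1) = ∑ s(bᵢ*) ⊗ t(bᵢ). -/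
theorem counit_mul (x y : B.M) : LinearMap.mul' ℂ ℂ
    (TensorProduct.map B.counit B.counit ((x ⊗ₜ 1) * B.comulTensor 1 * (1 ⊗ₜ y))) =
      B.counit (x * y) := by
  obtain ⟨b, hb⟩ := exists_isRegularBasis B.N
  obtain ⟨m, hm⟩ := B.targetCounit_mem y
  have hm' : B.targetCounit y = B.t m := hm.symm
  have h1 : B.counit (x * B.s m) =
      ∑ i, regularTrace B.N (m * b i) * B.counit (x * B.s (star (b i))) := by
    conv_lhs => rw [hb.expand_star m]
    simp [Finset.mul_sum]
  rw [← B.counit_congr (B.targetCounit_mul_targetCounit x y), hm', ← B.counit_mul_s, h1,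
    B.comulTensor_one, hb.fiberProjection_eq]
  simp [Finset.mul_sum, Finset.sum_mul, B.counit_t_mul hm', regularTrace_mul_comm m, mul_comm]

theorem map_sourceCounit_comul (x : B.M) :
    TensorProduct.map B.sourceCounit LinearMap.id (B.comulTensor x) =
      (1 ⊗ₜ x) * B.comulTensor 1 := by
  have h := congrArg B.S.flip (B.map_targetCounit_comul B.comul_counit (B.S x))
  rw [← B.S.map_id_flip B.sourceCounit_S, ← B.comulTensor_S, B.S_S, AntiStarHom.flip_mul,
    ← B.comulTensor_S, B.S.map_one, AntiStarHom.flip_tmul, B.S_S, B.S.map_one] at h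
  exact h

/-- The weak Kac algebra of a Kac bimodule. -/
noncomputable def toWeakKacAlgebra : WeakKacAlgebra.{u} where
  M := B.M
  comul := B.comulTensor
  comul_injective := (FiberedProduct.incl_injective B.s B.t).comp B.comul_injective
  coassoc := B.coassoc
  S := B.S
  S_S := B.S_S
  S_comul := B.S_comul
  counit := B.counit
  counit_comul := B.counit_comul
  comul_counit := B.comul_counit
  counit_S := B.counit_S
  counit_star := B.counit_star
  counit_mul := B.counit_mul
  sourceCounit_comul := B.map_sourceCounit_comul

end KacBimodule

/-! ### The functor -/

namespace KacBimodule.Hom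

variable {B B' : KacBimodule.{u}}

theorem targetCounit_total {B B' : CoinvolutiveHopfBimodule.{u}} (π : B.M →⋆ₐ[ℂ] B'.M)
    (hΔ : ∀ x, TensorProduct.map (π : B.M →ₗ[ℂ] B'.M) (π : B.M →ₗ[ℂ] B'.M)
      (B.comulTensor x) = B'.comulTensor (π x))
    (hS : ∀ x, π (B.S x) = B'.S (π x)) (x : B.M) :
    B'.targetCounit (π x) = π (B.targetCounit x) := by
  have key : ∀ z : B.M ⊗[ℂ] B.M, LinearMap.mul' ℂ B'.M (TensorProduct.map LinearMap.id
      B'.S.toLinearMap (TensorProduct.map (π : B.M →ₗ[ℂ] B'.M) (π : B.M →ₗ[ℂ] B'.M) z)) =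
      π (LinearMap.mul' ℂ B.M (TensorProduct.map LinearMap.id B.S.toLinearMap z)) := fun z => by
    induction z with
    | zero => simp
    | add a b ha hb => simp only [map_add, ha, hb]
    | tmul a b => simp [hS]
  have := key (B.comulTensor x)
  rw [hΔ] at this
  exact this

/-- The regular trace is invariant under the isomorphism of the bases, so preservation of the counit
is automatic. -/
theorem counit_total (f : Hom B B') (x : B.M) : B'.counit (f.total x) = B.counit x := by
  obtain ⟨m, hm⟩ := B.targetCounit_mem x
  have h : B'.targetCounit (f.total x) = B'.t (f.base m) := by
    rw [targetCounit_total f.total f.map_comul f.map_S, ← f.map_t]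
    exact congrArg _ hm.symm
  rw [B'.counit_eq h, B.counit_eq hm.symm]
  exact regularTrace_algEquiv f.base.toAlgEquiv m

theorem base_eq_of_total_eq {f g : Hom B B'} (h : f.total = g.total) : f = g := by
  refine Hom.ext (StarAlgEquiv.ext fun n => B'.t_injective ?_) h
  rw [← f.map_t, ← g.map_t, h]

/-- Compatibility with the counits determines the map on the bases. -/
theorem exists_of_weakKac (π : B.M →⋆ₐ[ℂ] B'.M)
    (hΔ : ∀ x, TensorProduct.map (π : B.M →ₗ[ℂ] B'.M) (π : B.M →ₗ[ℂ] B'.M)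
      (B.comulTensor x) = B'.comulTensor (π x))
    (hS : ∀ x, π (B.S x) = B'.S (π x)) (hε : ∀ x, B'.counit (π x) = B.counit x) :
    ∃ f : Hom B B', f.total = π := by
  -- The elements t(n) are fixed by ε_t, which π intertwines with the target counital map of B'.
  have hmem : ∀ n, π (B.t n) ∈ B'.t.range := fun n => by
    rw [← B.targetCounit_t, ← targetCounit_total π hΔ hS]
    exact B'.targetCounit_mem _
  let e := StarAlgEquiv.ofInjective B'.t B'.t_injective
  let g : B.N →⋆ₐ[ℂ] B'.N :=
    (e.symm : B'.t.range →⋆ₐ[ℂ] B'.N).comp ((π.comp B.t).codRestrict B'.t.range hmem)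
  have hg : ∀ n, B'.t (g n) = π (B.t n) := fun n =>
    congrArg Subtype.val (e.apply_symm_apply ⟨π (B.t n), hmem n⟩)
  have hinj : Function.Injective g := by
    rw [injective_iff_map_eq_zero]
    intro n hn
    apply (FaithfulFunctional.regularTrace_isFaithfulPositive B.N).definite
    rw [← B.counit_t, ← hε, ← hg, B'.counit_t, _root_.map_mul, hn, mul_zero, map_zero]
  have hsurj : Function.Surjective g := by
    intro n
    obtain ⟨b, hb⟩ := exists_isRegularBasis B.N
    obtain ⟨b', hb'⟩ := exists_isRegularBasis B'.N
    have h1 : ∑ i, B'.s (star (b' i)) ⊗ₜ[ℂ] B'.t (b' i) =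
        ∑ i, π (B.s (star (b i))) ⊗ₜ[ℂ] B'.t (g (b i)) := by
      rw [← hb'.fiberProjection_eq, ← B'.comulTensor_one, ← _root_.map_one π, ← hΔ,
        B.comulTensor_one, hb.fiberProjection_eq]
      simp [hg]
    -- Slicing the left leg by ε'(· t'(n)) yields t'(n) from the basis of N', and an element of
    -- t'(g(N)) from the basis of N.
    have h2 := congrArg (fun z => TensorProduct.lid ℂ B'.M (TensorProduct.map
      (B'.counit ∘ₗ LinearMap.mulRight ℂ (B'.t n)) LinearMap.id z)) h1
    have h3 : ∀ i, B'.counit (B'.s (star (b' i)) * B'.t n) =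
        regularTrace B'.N (star (b' i) * n) := fun i => by
      rw [B'.counit_s_mul (B'.targetCounit_t n), regularTrace_mul_comm]
    simp only [map_sum, TensorProduct.map_tmul, TensorProduct.lid_tmul, LinearMap.comp_apply,
      LinearMap.mulRight_apply, LinearMap.id_apply, h3, ← map_smul] at h2
    rw [← map_sum, ← hb'.expand n, ← map_sum, ← map_sum] at h2
    exact ⟨_, (B'.t_injective h2).symm⟩
  exact ⟨⟨StarAlgEquiv.ofBijective g ⟨hinj, hsurj⟩, π, fun n => (hg n).symm, hΔ, hS⟩, rfl⟩

end KacBimodule.Hom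

/-- The functor from Kac bimodules to weak Kac algebras. -/
noncomputable def kacToWeakKac : CategoryTheory.Functor KacBimodule.{u} WeakKacAlgebra.{u} where
  obj B := B.toWeakKacAlgebra
  map {B B'} f := (⟨KacBimodule.Hom.total f, KacBimodule.Hom.map_comul f,
    KacBimodule.Hom.map_S f, KacBimodule.Hom.counit_total f⟩ :
      WeakKacAlgebra.Hom B.toWeakKacAlgebra B'.toWeakKacAlgebra)
  map_id _ := rfl
  map_comp _ _ := rfl

instance : kacToWeakKac.{u}.Faithful where
  map_injective h := KacBimodule.Hom.base_eq_of_total_eq (congrArg WeakKacAlgebra.Hom.total h)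

instance : kacToWeakKac.{u}.Full where
  map_surjective {B B'} f := by
    obtain ⟨g, hg⟩ := KacBimodule.Hom.exists_of_weakKac (B := B) (B' := B')
      (WeakKacAlgebra.Hom.total f) (WeakKacAlgebra.Hom.map_comul f)
      (WeakKacAlgebra.Hom.map_S f) (WeakKacAlgebra.Hom.map_counit f)
    exact ⟨g, WeakKacAlgebra.Hom.ext hg⟩

/-! ### From weak Kac algebras to Kac bimodules -/

namespace WeakKacAlgebra

variable (A : WeakKacAlgebra.{u})

/-- The target counital map `ε_t = μ ∘ (id ⊗ S) ∘ Δ`. -/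
noncomputable def targetCounit : A.M →ₗ[ℂ] A.M :=
  LinearMap.mul' ℂ A.M ∘ₗ TensorProduct.map LinearMap.id A.S.toLinearMap ∘ₗ
    (A.comul : A.M →ₗ[ℂ] A.M ⊗[ℂ] A.M)

theorem targetCounit_apply (x : A.M) : A.targetCounit x =
    LinearMap.mul' ℂ A.M (TensorProduct.map LinearMap.id A.S.toLinearMap (A.comul x)) := rfl

theorem comul_S (x : A.M) : A.comul (A.S x) = A.S.flip (A.comul x) :=
  A.S.comul_apply (Δ := (A.comul : A.M →ₗ[ℂ] A.M ⊗[ℂ] A.M)) A.S_comul x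

theorem comul_mul_one (x : A.M) : A.comul x * A.comul 1 = A.comul x := by
  rw [← map_mul, mul_one]

theorem comul_one_mul (x : A.M) : A.comul 1 * A.comul x = A.comul x := by
  rw [← map_mul, one_mul]

theorem star_comul_one : star (A.comul 1) = A.comul 1 := by
  rw [← map_star, star_one]

theorem flip_comul_one : A.S.flip (A.comul 1) = A.comul 1 := by
  rw [← A.comul_S, A.S.map_one]

theorem sourceCounit_S (x : A.M) : A.sourceCounit (A.S x) = A.S (A.targetCounit x) := by
  have : A.sourceCounit (A.S x) = LinearMap.mul' ℂ A.M
      (TensorProduct.map A.S.toLinearMap LinearMap.id (A.comul (A.S x))) := rfl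
  rw [this, A.comul_S, AntiStarHom.mul_map_id_flip]
  rfl

theorem sourceCounit_eq (x : A.M) : A.sourceCounit x = A.S (A.targetCounit (A.S x)) := by
  rw [← sourceCounit_S, A.S_S]

theorem map_targetCounit_comul (x : A.M) :
    TensorProduct.map LinearMap.id A.targetCounit (A.comul x) = A.comul 1 * (x ⊗ₜ 1) := by
  have h : ∀ y, A.targetCounit (A.S y) = A.S (A.sourceCounit y) := fun y => by
    rw [sourceCounit_eq, A.S_S]
  have := congrArg A.S.flip (A.sourceCounit_comul (A.S x))
  rw [← A.S.id_map_flip h, ← A.comul_S, A.S_S, AntiStarHom.flip_mul, flip_comul_one,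
    AntiStarHom.flip_tmul, A.S_S, A.S.map_one] at this
  exact this

theorem map_targetCounit_comul_one :
    TensorProduct.map LinearMap.id A.targetCounit (A.comul 1) = A.comul 1 := by
  rw [map_targetCounit_comul, ← Algebra.TensorProduct.one_def, mul_one]

theorem map_sourceCounit_comul_one :
    TensorProduct.map A.sourceCounit LinearMap.id (A.comul 1) = A.comul 1 := by
  rw [A.sourceCounit_comul, ← Algebra.TensorProduct.one_def, one_mul]

/-- `ε_t(x) = (ε ⊗ id)(Δ(1) (x ⊗ 1))` -/
theorem targetCounit_eq (x : A.M) : A.targetCounit x = TensorProduct.lid ℂ A.M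
    (TensorProduct.map A.counit LinearMap.id (A.comul 1 * (x ⊗ₜ 1))) := by
  have key : ∀ z : A.M ⊗[ℂ] A.M, TensorProduct.lid ℂ A.M (TensorProduct.map A.counit LinearMap.id
      (TensorProduct.map LinearMap.id A.targetCounit z)) = A.targetCounit
        (TensorProduct.lid ℂ A.M (TensorProduct.map A.counit LinearMap.id z)) := fun z => by
    induction z with
    | zero => simp
    | add a b ha hb => simp only [map_add, ha, hb]
    | tmul a b => simp
  rw [← map_targetCounit_comul, key, A.counit_comul]

/-- By the slice formula this is (ε ⊗ ε)(Δ(1)(x ⊗ 1)); applying the right counit first leaves ε(1 ·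
x). -/
theorem counit_targetCounit (x : A.M) : A.counit (A.targetCounit x) = A.counit x := by
  have key : ∀ z : A.M ⊗[ℂ] A.M,
      A.counit (TensorProduct.lid ℂ A.M (TensorProduct.map A.counit LinearMap.id (z * (x ⊗ₜ 1)))) =
      A.counit (TensorProduct.rid ℂ A.M (TensorProduct.map LinearMap.id A.counit z) * x) := by
    intro z
    induction z with
    | zero => simp
    | add a b ha hb => simp only [map_add, add_mul, ha, hb]
    | tmul a b => simp [mul_comm]
  rw [targetCounit_eq, key, A.comul_counit, one_mul]

theorem targetCounit_one : A.targetCounit 1 = 1 := by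
  rw [targetCounit_eq, ← Algebra.TensorProduct.one_def, mul_one, A.counit_comul]

/-- `(id ⊗ Δ) Δ(1) = (1 ⊗ Δ(1)) (Δ(1) ⊗ 1)` -/
theorem map_comul_comul_one :
    TensorProduct.map LinearMap.id (A.comul : A.M →ₗ[ℂ] A.M ⊗[ℂ] A.M) (A.comul 1) =
      (1 ⊗ₜ A.comul 1) * TensorProduct.assoc ℂ A.M A.M A.M (A.comul 1 ⊗ₜ 1) := by
  have k1 : ∀ z : A.M ⊗[ℂ] A.M,
      TensorProduct.assoc ℂ A.M A.M A.M (TensorProduct.map (A.comul : A.M →ₗ[ℂ] A.M ⊗[ℂ] A.M)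
        LinearMap.id (TensorProduct.map LinearMap.id A.targetCounit z)) =
      TensorProduct.map LinearMap.id (TensorProduct.map LinearMap.id A.targetCounit)
        (TensorProduct.assoc ℂ A.M A.M A.M (TensorProduct.map
          (A.comul : A.M →ₗ[ℂ] A.M ⊗[ℂ] A.M) LinearMap.id z)) := fun z => by
    induction z with
    | zero => simp
    | add a b ha hb => simp only [map_add, ha, hb]
    | tmul a b =>
      simp only [TensorProduct.map_tmul, LinearMap.id_apply]
      generalize (A.comul : A.M →ₗ[ℂ] A.M ⊗[ℂ] A.M) a = w
      induction w with
      | zero => simp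
      | add c d hc hd => simp only [TensorProduct.add_tmul, map_add, hc, hd]
      | tmul c d => simp
  have k2 : ∀ z : A.M ⊗[ℂ] A.M,
      TensorProduct.map LinearMap.id (TensorProduct.map LinearMap.id A.targetCounit)
        (TensorProduct.map LinearMap.id (A.comul : A.M →ₗ[ℂ] A.M ⊗[ℂ] A.M) z) =
      (1 ⊗ₜ A.comul 1) * TensorProduct.assoc ℂ A.M A.M A.M (z ⊗ₜ 1) := fun z => by
    induction z with
    | zero => simp
    | add a b ha hb => simp only [map_add, TensorProduct.add_tmul, mul_add, ha, hb]
    | tmul a b =>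
      have := A.map_targetCounit_comul b
      simpa using congrArg (a ⊗ₜ[ℂ] ·) this
  -- Apply id ⊗ id ⊗ ε_t to coassociativity at 1: one side is unchanged because id ⊗ ε_t fixes Δ(1),
  -- the other becomes the product.
  have h := k1 (A.comul 1)
  rw [map_targetCounit_comul_one, A.coassoc, k2] at h
  exact h

/-- `(id ⊗ Δ) Δ(1) = (Δ(1) ⊗ 1) (1 ⊗ Δ(1))` -/
theorem map_comul_comul_one' :
    TensorProduct.map LinearMap.id (A.comul : A.M →ₗ[ℂ] A.M ⊗[ℂ] A.M) (A.comul 1) =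
      TensorProduct.assoc ℂ A.M A.M A.M (A.comul 1 ⊗ₜ 1) * (1 ⊗ₜ A.comul 1) := by
  have k1 : ∀ z : A.M ⊗[ℂ] A.M,
      star (TensorProduct.map LinearMap.id (A.comul : A.M →ₗ[ℂ] A.M ⊗[ℂ] A.M) z) =
      TensorProduct.map LinearMap.id (A.comul : A.M →ₗ[ℂ] A.M ⊗[ℂ] A.M) (star z) := fun z => by
    induction z with
    | zero => simp
    | add a b ha hb => simp only [map_add, star_add, ha, hb]
    | tmul a b => simp [map_star]
  have k2 : ∀ z : A.M ⊗[ℂ] A.M, star (TensorProduct.assoc ℂ A.M A.M A.M (z ⊗ₜ 1)) =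
      TensorProduct.assoc ℂ A.M A.M A.M (star z ⊗ₜ 1) := fun z => by
    induction z with
    | zero => simp
    | add a b ha hb => simp only [TensorProduct.add_tmul, map_add, star_add, ha, hb]
    | tmul a b => simp
  have h := congrArg star A.map_comul_comul_one
  rw [k1, star_comul_one, star_mul, k2, TensorProduct.star_tmul, star_one, star_comul_one] at h
  exact h

theorem comul_targetCounit_aux (x : A.M) : A.comul (A.targetCounit x) =
    TensorProduct.lid ℂ (A.M ⊗[ℂ] A.M) (TensorProduct.map A.counit LinearMap.id
      (TensorProduct.map LinearMap.id (A.comul : A.M →ₗ[ℂ] A.M ⊗[ℂ] A.M) (A.comul 1) *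
        (x ⊗ₜ 1))) := by
  have key : ∀ z : A.M ⊗[ℂ] A.M,
      A.comul (TensorProduct.lid ℂ A.M (TensorProduct.map A.counit LinearMap.id (z * (x ⊗ₜ 1)))) =
      TensorProduct.lid ℂ (A.M ⊗[ℂ] A.M) (TensorProduct.map A.counit LinearMap.id
        (TensorProduct.map LinearMap.id (A.comul : A.M →ₗ[ℂ] A.M ⊗[ℂ] A.M) z *
          (x ⊗ₜ 1))) := fun z => by
    induction z with
    | zero => simp
    | add a b ha hb => simp only [map_add, add_mul, ha, hb]
    | tmul a b => simp
  rw [targetCounit_eq, key]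

/-- ε_t(x) is a slice of Δ(1), so Δ(ε_t(x)) is the same slice of (id ⊗ Δ)Δ(1). Its two
factorizations place Δ(1) on either side. -/
theorem comul_targetCounit (x : A.M) :
    A.comul (A.targetCounit x) = A.comul 1 * (A.targetCounit x ⊗ₜ 1) := by
  have key : ∀ z : A.M ⊗[ℂ] A.M,
      TensorProduct.lid ℂ (A.M ⊗[ℂ] A.M) (TensorProduct.map A.counit LinearMap.id
        ((1 ⊗ₜ A.comul 1) * TensorProduct.assoc ℂ A.M A.M A.M (z ⊗ₜ 1) * (x ⊗ₜ 1))) =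
      A.comul 1 * (TensorProduct.lid ℂ A.M
        (TensorProduct.map A.counit LinearMap.id (z * (x ⊗ₜ 1))) ⊗ₜ 1) := fun z => by
    induction z with
    | zero => simp
    | add a b ha hb => simp only [map_add, add_mul, mul_add, TensorProduct.add_tmul, ha, hb]
    | tmul a b => simp [← TensorProduct.smul_tmul']
  rw [comul_targetCounit_aux, map_comul_comul_one, key, ← targetCounit_eq]

theorem comul_targetCounit' (x : A.M) :
    A.comul (A.targetCounit x) = (A.targetCounit x ⊗ₜ 1) * A.comul 1 := by
  have key : ∀ z : A.M ⊗[ℂ] A.M,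
      TensorProduct.lid ℂ (A.M ⊗[ℂ] A.M) (TensorProduct.map A.counit LinearMap.id
        (TensorProduct.assoc ℂ A.M A.M A.M (z ⊗ₜ 1) * (1 ⊗ₜ A.comul 1) * (x ⊗ₜ 1))) =
      (TensorProduct.lid ℂ A.M
        (TensorProduct.map A.counit LinearMap.id (z * (x ⊗ₜ 1))) ⊗ₜ 1) * A.comul 1 := fun z => by
    induction z with
    | zero => simp
    | add a b ha hb => simp only [map_add, add_mul, TensorProduct.add_tmul, ha, hb]
    | tmul a b => simp [← TensorProduct.smul_tmul']
  rw [comul_targetCounit_aux, map_comul_comul_one', key, ← targetCounit_eq]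

/-! ### The base algebra of a weak Kac algebra -/

/-- The target counital subalgebra, the range of `ε_t`. -/
def base : StarSubalgebra ℂ A.M where
  carrier := {n | A.comul n = (n ⊗ₜ 1) * A.comul 1 ∧ A.comul n = A.comul 1 * (n ⊗ₜ 1)}
  mul_mem' {a b} ha hb := by
    constructor
    · rw [map_mul, ha.1, mul_assoc, comul_one_mul, hb.1, ← mul_assoc]
      simp
    · rw [map_mul, hb.2, ← mul_assoc, comul_mul_one, ha.2, mul_assoc]
      simp
  add_mem' {a b} ha hb := by
    constructor
    · rw [map_add, ha.1, hb.1, TensorProduct.add_tmul, add_mul]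
    · rw [map_add, ha.2, hb.2, TensorProduct.add_tmul, mul_add]
  algebraMap_mem' c := by
    rw [Algebra.algebraMap_eq_smul_one]
    constructor
    · rw [map_smul, ← TensorProduct.smul_tmul', smul_mul_assoc, ← Algebra.TensorProduct.one_def,
        one_mul]
    · rw [map_smul, ← TensorProduct.smul_tmul', mul_smul_comm, ← Algebra.TensorProduct.one_def,
        mul_one]
  star_mem' {a} ha := by
    constructor
    · rw [map_star, ha.2, star_mul, star_comul_one, TensorProduct.star_tmul, star_one]
    · rw [map_star, ha.1, star_mul, star_comul_one, TensorProduct.star_tmul, star_one]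

theorem targetCounit_mem_base (x : A.M) : A.targetCounit x ∈ A.base :=
  ⟨A.comul_targetCounit' x, A.comul_targetCounit x⟩

instance : IsClosed (A.base : Set A.M) :=
  Submodule.closed_of_finiteDimensional (Subalgebra.toSubmodule A.base.toSubalgebra)

instance : FiniteDimensional ℂ A.base :=
  inferInstanceAs (FiniteDimensional ℂ (Subalgebra.toSubmodule A.base.toSubalgebra))

theorem comul_base_mul {n : A.M} (hn : n ∈ A.base) (x : A.M) :
    A.comul (n * x) = (n ⊗ₜ 1) * A.comul x := by
  rw [map_mul, hn.1, mul_assoc, comul_one_mul]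

theorem comul_S_base {n : A.M} (hn : n ∈ A.base) :
    A.comul (A.S n) = (1 ⊗ₜ A.S n) * A.comul 1 := by
  rw [comul_S, hn.2, AntiStarHom.flip_mul, flip_comul_one, AntiStarHom.flip_tmul, A.S.map_one]

theorem comul_S_base_mul {n : A.M} (hn : n ∈ A.base) (x : A.M) :
    A.comul (A.S n * x) = (1 ⊗ₜ A.S n) * A.comul x := by
  rw [map_mul, A.comul_S_base hn, mul_assoc, comul_one_mul]

/-- Δ sends both products to (n ⊗ S(m))Δ(1), and Δ is injective. -/
theorem S_mul_comm {m n : A.M} (hm : m ∈ A.base) (hn : n ∈ A.base) :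
    A.S m * n = n * A.S m := by
  apply A.comul_injective
  rw [A.comul_S_base_mul hm, A.comul_base_mul hn, A.comul_S_base hm, hn.1, ← mul_assoc,
    ← mul_assoc]
  simp

theorem targetCounit_base_mul {n : A.M} (hn : n ∈ A.base) (x : A.M) :
    A.targetCounit (n * x) = n * A.targetCounit x := by
  have key : ∀ z : A.M ⊗[ℂ] A.M,
      LinearMap.mul' ℂ A.M (TensorProduct.map LinearMap.id A.S.toLinearMap ((n ⊗ₜ 1) * z)) =
      n * LinearMap.mul' ℂ A.M (TensorProduct.map LinearMap.id A.S.toLinearMap z) := fun z => by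
    induction z with
    | zero => simp
    | add a b ha hb => simp only [map_add, mul_add, ha, hb]
    | tmul a b => simp [mul_assoc]
  rw [targetCounit_apply, A.comul_base_mul hn, key]
  rfl

theorem targetCounit_S_base_mul {n : A.M} (hn : n ∈ A.base) (x : A.M) :
    A.targetCounit (A.S n * x) = A.targetCounit x * n := by
  have key : ∀ z : A.M ⊗[ℂ] A.M,
      LinearMap.mul' ℂ A.M (TensorProduct.map LinearMap.id A.S.toLinearMap
        ((1 ⊗ₜ A.S n) * z)) =
      LinearMap.mul' ℂ A.M (TensorProduct.map LinearMap.id A.S.toLinearMap z) * n := fun z => by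
    induction z with
    | zero => simp
    | add a b ha hb => simp only [map_add, mul_add, add_mul, ha, hb]
    | tmul a b => simp [mul_assoc, A.S.map_mul, A.S_S]
  rw [targetCounit_apply, A.comul_S_base_mul hn, key]
  rfl

/-- Together with `targetCounit_mem_base`, this identifies the subalgebra with the range of ε_t. -/
theorem targetCounit_base {n : A.M} (hn : n ∈ A.base) : A.targetCounit n = n := by
  have := A.targetCounit_base_mul hn 1
  rwa [mul_one, targetCounit_one, mul_one] at this

/-! ### Separability of Δ(1) over the base -/

/-- `Δ(1)` belongs to `S(N) ⊗ N`, where `N` is the target counital subalgebra. -/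
theorem exists_comul_one_eq : ∃ (k : ℕ) (a c : Fin k → A.base),
    A.comul 1 = ∑ i, A.S (a i) ⊗ₜ[ℂ] (c i : A.M) := by
  obtain ⟨k, p, q, h⟩ := TensorProduct.exists_sum_tmul_eq (A.comul 1)
  refine ⟨k, fun i => ⟨A.targetCounit (A.S (p i)), A.targetCounit_mem_base _⟩,
    fun i => ⟨A.targetCounit (q i), A.targetCounit_mem_base _⟩, ?_⟩
  have h1 : A.comul 1 = ∑ i, p i ⊗ₜ[ℂ] A.targetCounit (q i) := by
    conv_lhs => rw [← map_targetCounit_comul_one, h]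
    simp
  -- Δ(1) is also fixed by ε_s ⊗ id, and ε_s = S ε_t S puts the first leg in S(N).
  conv_lhs => rw [← map_sourceCounit_comul_one, h1]
  simp [sourceCounit_eq]

theorem sum_mul_eq_one {k : ℕ} {a c : Fin k → A.base}
    (h : A.comul 1 = ∑ i, A.S (a i) ⊗ₜ[ℂ] (c i : A.M)) : ∑ i, c i * a i = 1 := by
  have h1 := congrArg A.S A.targetCounit_one
  rw [targetCounit_apply, h] at h1
  apply Subtype.ext
  simpa [A.S.map_mul, A.S_S, A.S.map_one] using h1

theorem sum_mul_eq_one' {k : ℕ} {a c : Fin k → A.base}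
    (h : A.comul 1 = ∑ i, A.S (a i) ⊗ₜ[ℂ] (c i : A.M)) : ∑ i, (a i : A.M) * c i = 1 := by
  have h1 : A.sourceCounit 1 = 1 := by
    rw [sourceCounit_eq, A.S.map_one, targetCounit_one, A.S.map_one]
  have h2 : A.sourceCounit 1 = LinearMap.mul' ℂ A.M
      (TensorProduct.map A.S.toLinearMap LinearMap.id (A.comul 1)) := rfl
  rw [h2, h] at h1
  simpa [A.S_S] using h1

/-- The formula n = ε_t(n) = ∑ ε(n aᵢ) cᵢ is reproducing and ∑ cᵢ aᵢ = 1, which forces the regular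
trace to be ε. -/
theorem regularTrace_base (n : A.base) : regularTrace A.base n = A.counit n := by
  obtain ⟨k, a, c, h⟩ := A.exists_comul_one_eq
  have hr : ∀ n : A.base, n = ∑ i, (A.counit ∘ₗ A.base.subtype.toAlgHom.toLinearMap)
      (n * a i) • c i := fun n => by
    have h1 : ∀ i, A.counit (A.S (a i) * n) = A.counit ((n : A.M) * a i) := fun i => by
      rw [← counit_targetCounit, A.targetCounit_S_base_mul (a i).2, A.targetCounit_base n.2]
    apply Subtype.ext
    conv_lhs => rw [← A.targetCounit_base n.2, targetCounit_eq, h]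
    simp [Finset.sum_mul, h1]
  rw [regularTrace_eq_of_reproducing _ _ _ hr, A.sum_mul_eq_one h, mul_one]
  rfl

/-- The source map `n ↦ S(n)` of the target counital subalgebra. -/
def source : AntiStarHom A.base A.M where
  toLinearMap := A.S.toLinearMap ∘ₗ A.base.subtype.toAlgHom.toLinearMap
  map_one' := A.S.map_one
  map_mul' x y := A.S.map_mul x y
  map_star' x := A.S.map_star x

theorem source_apply (n : A.base) : A.source n = A.S n := rfl

/-- Compute (id ⊗ ε_t)Δ(S(n)) in two ways: it is Δ(1)(S(n) ⊗ 1), and it also follows from Δ(S(n)) =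
(1 ⊗ S(n))Δ(1). -/
theorem comul_one_mul_S_tmul {n : A.M} (hn : n ∈ A.base) :
    A.comul 1 * (A.S n ⊗ₜ 1) = A.comul 1 * (1 ⊗ₜ n) := by
  have key : ∀ z : A.M ⊗[ℂ] A.M,
      TensorProduct.map LinearMap.id A.targetCounit ((1 ⊗ₜ A.S n) * z) =
      TensorProduct.map LinearMap.id A.targetCounit z * (1 ⊗ₜ n) := fun z => by
    induction z with
    | zero => simp
    | add a b ha hb => simp only [map_add, mul_add, add_mul, ha, hb]
    | tmul a b => simp [A.targetCounit_S_base_mul hn]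
  rw [← map_targetCounit_comul, A.comul_S_base hn, key, map_targetCounit_comul_one]

theorem comul_one_eq_fiberProjection :
    A.comul 1 = fiberProjection A.source A.base.subtype := by
  refine eq_fiberProjection _ _ _ ⟨A.comul_mul_one 1, A.star_comul_one⟩ fun x => ?_
  rw [RelativeTensor.mk, Submodule.mkQ_apply, Submodule.Quotient.mk_eq_zero]
  constructor
  · intro hx
    obtain ⟨k, a, c, h⟩ := A.exists_comul_one_eq
    have key : x - A.comul 1 * x ∈ balancedRelations A.source A.base.subtype := by
      clear hx
      induction x with
      | zero => simp
      | add x y hx hy =>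
        rw [mul_add, add_sub_add_comm]
        exact add_mem hx hy
      | tmul ζ η =>
        have e : ζ ⊗ₜ[ℂ] η - A.comul 1 * (ζ ⊗ₜ η) =
            - ∑ i, ((A.source (a i) * ζ) ⊗ₜ[ℂ] ((c i : A.M) * η) -
              ζ ⊗ₜ[ℂ] (A.base.subtype (a i) * (c i * η))) := by
          rw [Finset.sum_sub_distrib, ← TensorProduct.tmul_sum]
          simp only [StarSubalgebra.subtype_apply, ← mul_assoc]
          rw [← Finset.sum_mul, A.sum_mul_eq_one' h, h]
          simp [Finset.sum_mul, source_apply]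
        rw [e]
        exact neg_mem (sum_mem fun i _ => Submodule.subset_span ⟨_, _, _, rfl⟩)
    rwa [hx, sub_zero] at key
  · intro hx
    induction hx using Submodule.span_induction with
    | mem x h =>
      obtain ⟨n, ζ, η, rfl⟩ := h
      have e1 : (A.source n * ζ) ⊗ₜ[ℂ] η = (A.S n ⊗ₜ 1) * (ζ ⊗ₜ η) := by simp [source_apply]
      have e2 : ζ ⊗ₜ[ℂ] (A.base.subtype n * η) = (1 ⊗ₜ (n : A.M)) * (ζ ⊗ₜ η) := by simp
      rw [mul_sub, e1, e2, ← mul_assoc, ← mul_assoc, A.comul_one_mul_S_tmul n.2, sub_self]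
    | zero => simp
    | add x y _ _ hx hy => rw [mul_add, hx, hy, add_zero]
    | smul c x _ hx => rw [mul_smul_comm, hx, smul_zero]

/-- The coproduct as a unital homomorphism into the fibered product. -/
noncomputable def fiberedComul : A.M →⋆ₐ[ℂ] FiberedProduct A.source A.base.subtype :=
  let f : A.M → FiberedProduct A.source A.base.subtype := fun x =>
    FiberedProduct.ofMem _ _ (A.comul x)
      (by rw [← comul_one_eq_fiberProjection, comul_one_mul])
      (by rw [← comul_one_eq_fiberProjection, comul_mul_one])
  have h1 : f 1 = 1 :=
    FiberedProduct.incl_injective _ _ A.comul_one_eq_fiberProjection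
  have hs : ∀ (c : ℂ) x, f (c • x) = c • f x := fun c x =>
    FiberedProduct.incl_injective _ _ (map_smul A.comul c x)
  { toFun := f
    map_one' := h1
    map_mul' := fun x y => FiberedProduct.incl_injective _ _ (map_mul A.comul x y)
    map_zero' := FiberedProduct.incl_injective _ _ (map_zero A.comul)
    map_add' := fun x y => FiberedProduct.incl_injective _ _ (map_add A.comul x y)
    commutes' := fun c => by
      change f (algebraMap ℂ A.M c) = _
      rw [Algebra.algebraMap_eq_smul_one, hs, h1, Algebra.algebraMap_eq_smul_one]
    map_star' := fun x => FiberedProduct.incl_injective _ _ (map_star A.comul x) }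

/-! ### Assembly of the Kac bimodule and the equivalence -/

/-- The Hopf bimodule of a weak Kac algebra. -/
noncomputable def toHopfBimodule : HopfBimodule.{u} where
  N := A.base
  M := A.M
  t := A.base.subtype
  s := A.source
  t_injective := Subtype.val_injective
  s_injective x y h := by
    have := congrArg A.S h
    rw [source_apply, source_apply, A.S_S, A.S_S] at this
    exact Subtype.ext this
  comul := A.fiberedComul
  comul_injective x y h := A.comul_injective (congrArg (FiberedProduct.incl _ _) h)
  s_t_comm n n' := A.S_mul_comm n.2 n'.2
  comul_t n := by
    rw [← comul_one_eq_fiberProjection]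
    exact n.2.1
  comul_s n := by
    rw [← comul_one_eq_fiberProjection]
    exact A.comul_S_base n.2
  coassoc := A.coassoc

/-- The coinvolutive Hopf bimodule of a weak Kac algebra. -/
noncomputable def toCoinvolutiveHopfBimodule : CoinvolutiveHopfBimodule.{u} where
  toHopfBimodule := A.toHopfBimodule
  S := A.S
  S_S := A.S_S
  S_t _ := rfl
  S_comul := A.S_comul

/-- The counital Hopf bimodule of a weak Kac algebra. -/
noncomputable def toCounitalHopfBimodule : CounitalHopfBimodule.{u} where
  toCoinvolutiveHopfBimodule := A.toCoinvolutiveHopfBimodule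
  targetCounit_one := A.targetCounit_one
  targetCounit_mem x := ⟨⟨A.targetCounit x, A.targetCounit_mem_base x⟩, rfl⟩
  targetCounit_bimodule (n n' : A.base) (x : A.M) := by
    change A.targetCounit (n.1 * A.S n'.1 * x) = n.1 * A.targetCounit x * n'.1
    rw [mul_assoc, A.targetCounit_base_mul n.2, A.targetCounit_S_base_mul n'.2, mul_assoc]

theorem toCounitalHopfBimodule_counit : A.toCounitalHopfBimodule.counit = A.counit := by
  refine LinearMap.ext fun x => ?_
  have h := A.toCounitalHopfBimodule.counit_eq (x := x)
    (n := ⟨A.targetCounit x, A.targetCounit_mem_base x⟩) rfl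
  refine h.trans ((A.regularTrace_base _).trans (A.counit_targetCounit x))

/-- The Kac bimodule of a weak Kac algebra. -/
noncomputable def toKacBimodule : KacBimodule.{u} where
  toCounitalHopfBimodule := A.toCounitalHopfBimodule
  comul_counit x := by
    rw [toCounitalHopfBimodule_counit]
    exact A.comul_counit x

/-- The weak Kac algebra of `A.toKacBimodule` is isomorphic to `A`. -/
noncomputable def toKacBimoduleIso : A.toKacBimodule.toWeakKacAlgebra ≅ A where
  hom :=
    { total := StarAlgHom.id ℂ A.M
      map_comul := WeakKacAlgebra.Hom.map_comul (CategoryTheory.CategoryStruct.id A)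
      map_S := fun _ => rfl
      map_counit := fun x => (LinearMap.congr_fun A.toCounitalHopfBimodule_counit x).symm }
  inv :=
    { total := StarAlgHom.id ℂ A.M
      map_comul := WeakKacAlgebra.Hom.map_comul (CategoryTheory.CategoryStruct.id A)
      map_S := fun _ => rfl
      map_counit := fun x => LinearMap.congr_fun A.toCounitalHopfBimodule_counit x }
  hom_inv_id := rfl
  inv_hom_id := rfl

end WeakKacAlgebra

instance : kacToWeakKac.{u}.EssSurj where
  mem_essImage A := ⟨A.toKacBimodule, ⟨A.toKacBimoduleIso⟩⟩

instance : kacToWeakKac.{u}.IsEquivalence where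

theorem mainTheorem3 :
    ∃ (E : KacBimodule.{u} ≌ WeakKacAlgebra.{u})
      (φ : ∀ B : KacBimodule.{u}, B.M ≃⋆ₐ[ℂ] (E.functor.obj B).M),
      (∀ (B : KacBimodule.{u}) (x : B.M),
        TensorProduct.map (φ B : B.M →ₗ[ℂ] (E.functor.obj B).M)
            (φ B : B.M →ₗ[ℂ] (E.functor.obj B).M) (B.comulTensor x) =
          (E.functor.obj B).comul (φ B x)) ∧
      (∀ (B : KacBimodule.{u}) (x : B.M), φ B (B.S x) = (E.functor.obj B).S (φ B x)) ∧
      (∀ (B : KacBimodule.{u}) (x : B.M), (E.functor.obj B).counit (φ B x) = B.counit x) ∧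
      (∀ (B B' : KacBimodule.{u}) (f : B ⟶ B') (x : B.M),
        (E.functor.map f).total (φ B x) = φ B' (KacBimodule.Hom.total f x)) := by
  -- The functor keeps the total algebra and its maps, so the comparison isomorphisms are
  -- identities.
  refine ⟨kacToWeakKac.asEquivalence, fun B => StarAlgEquiv.refl ℂ B.M, fun B x => ?_,
    fun _ _ => rfl, fun _ _ => rfl, fun _ _ _ _ => rfl⟩
  exact WeakKacAlgebra.Hom.map_comul (CategoryTheory.CategoryStruct.id B.toWeakKacAlgebra) x
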